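/- Let $R$ be a commutative ring with identity; complexes of $R$-modules are indexed homologically by $\mathbb{Z}$. Definitions. A module is Gorenstein projective if it is isomorphic to $\operatorname{Coker}(X_1\to X_0)$ for an exact complex $X$ of projective modules such that $\operatorname{Hom}_R(X,P)$ is exact for every projective $P$; it is Gorenstein injective if it is isomorphic to $\operatorname{Ker}(Y_0\to Y_{-1})$ for an exact complex $Y$ of injective modules such that $\operatorname{Hom}_R(I,Y)$ is exact for every injective $I$. The Gorenstein projective dimension $\mathcal{GP}\text{-}\mathrm{pd}_R(M)$ is the infimum of the lengths $\sup\{n\ge 0 : X_n\ne 0\}$ of resolutions $X\to M$ by Gorenstein projective modules, and the Gorenstein injective dimension $\mathcal{GI}\text{-}\mathrm{id}_R(N)$ is defined dually. A Tate projective resolution of $M$ is a diagram of chain maps $T\xrightarrow{\alpha}W\to M$ in which $W\to M$ is a projective resolution, $T$ is an exact complex of projective modules with $\operatorname{Hom}_R(T,P)$ exact for every projective $P$, and $\alpha_n$ is an isomorphism for all $n\gg 0$. A Tate injective coresolution of $N$ is a diagram $N\to V\xrightarrow{\beta}S$ in which $N\to V$ is an injective coresolution, $S$ is an exact complex of injective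 modules with $\operatorname{Hom}_R(I,S)$ exact for every injective $I$, and $\beta_n$ is an isomorphism for all $n\ll 0$. For $n\in\mathbb{Z}$ set $$\widehat{\operatorname{Ext}}^n_{\mathcal P}(M,N)=H_{-n}(\operatorname{Hom}_R(T,N)),\qquad \widehat{\operatorname{Ext}}^n_{\mathcal I}(M,N)=H_{-n}(\operatorname{Hom}_R(M,S)).$$ Corollary 6.3. Let $M$ and $N$ be $R$-modules such that $\mathcal{GP}\text{-}\mathrm{pd}_R(M)<\infty$ and $\mathcal{GI}\text{-}\mathrm{id}_R(N)<\infty$. Then $M$ has a Tate projective resolution, $N$ has a Tate injective coresolution, and, whichever of these are used to compute the two Tate cohomologies, for each $n\ge 1$ there is an isomorphism of $R$-modules $$\widehat{\operatorname{Ext}}^n_{\mathcal P}(M,N)\cong\widehat{\operatorname{Ext}}^n_{\mathcal I}(M,N).$$ If $R$ is Gorenstein (that is, noetherian, with $R_{\mathfrak p}$ of finite injective dimension over itself for every prime $\mathfrak p$), then this isomorphism holds for all $n\in\mathbb{Z}$. -/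

import Mathlib

open CategoryTheory CategoryTheory.Limits Opposite

universe v u

noncomputable section

namespace RelTate

section Abelian

variable {C : Type u} [Category.{v} C] [Abelian C]

/-- An object regarded as a complex concentrated in degree `0`. Complexes are indexed
homologically by all integers, so the differentials are `X.d n (n - 1)`. -/
abbrev inDegreeZero (M : C) : ChainComplex C ℤ :=
  (HomologicalComplex.single C (ComplexShape.down ℤ) 0).obj M

/-- The complex of abelian groups `Hom(A, X)`, for an object `A` and a complex `X`. -/
abbrev homFrom (A : C) (X : ChainComplex C ℤ) :
    HomologicalComplex AddCommGrpCat.{v} (ComplexShape.down ℤ) :=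
  ((preadditiveCoyoneda.obj (op A)).mapHomologicalComplex (ComplexShape.down ℤ)).obj X

/-- The complex of abelian groups `Hom(X, A)`, for an object `A` and a complex `X`, with
`Hom(X_n, A)` placed in cohomological degree `n`. -/
abbrev homTo (X : ChainComplex C ℤ) (A : C) :
    HomologicalComplex AddCommGrpCat.{v} (ComplexShape.down ℤ).symm :=
  ((preadditiveYoneda.obj A).mapHomologicalComplex (ComplexShape.down ℤ).symm).obj X.op

/-- `X` is `Hom(𝒲, -)`-exact. -/
def IsHomFromExact (𝒲 : ObjectProperty C) (X : ChainComplex C ℤ) : Prop :=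
  ∀ A : C, 𝒲 A → (homFrom A X).Acyclic

/-- `X` is `Hom(-, 𝒲)`-exact. -/
def IsHomToExact (𝒲 : ObjectProperty C) (X : ChainComplex C ℤ) : Prop :=
  ∀ A : C, 𝒲 A → (homTo X A).Acyclic

/-- An `𝒳`-resolution of `M`: a complex `X` of objects of `𝒳`, zero in negative degrees, with a
quasi-isomorphism `X ⟶ M`. -/
structure Resolution (𝒳 : ObjectProperty C) (M : C) where
  X : ChainComplex C ℤ
  γ : X ⟶ inDegreeZero M
  mem : ∀ n : ℤ, 0 ≤ n → 𝒳 (X.X n)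
  isZero : ∀ n : ℤ, n < 0 → IsZero (X.X n)
  quasiIso : QuasiIso γ

/-- A `𝒴`-coresolution of `N`: a complex `Y` of objects of `𝒴`, zero in positive (homological)
degrees, with a quasi-isomorphism `N ⟶ Y`. -/
structure Coresolution (𝒴 : ObjectProperty C) (N : C) where
  Y : ChainComplex C ℤ
  δ : inDegreeZero N ⟶ Y
  mem : ∀ n : ℤ, n ≤ 0 → 𝒴 (Y.X n)
  isZero : ∀ n : ℤ, 0 < n → IsZero (Y.X n)
  quasiIso : QuasiIso δ

/-- The resolution is proper: its augmentation `⋯ ⟶ X₁ ⟶ X₀ ⟶ M ⟶ 0` is `Hom(𝒳, -)`-exact, i.e.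
`Hom(A, X) ⟶ Hom(A, M)` is a quasi-isomorphism for each `A` in `𝒳`. -/
def Resolution.IsProper {𝒳 : ObjectProperty C} {M : C} (ρ : Resolution 𝒳 M) : Prop :=
  ∀ A : C, 𝒳 A → QuasiIso
    (((preadditiveCoyoneda.obj (op A)).mapHomologicalComplex (ComplexShape.down ℤ)).map ρ.γ)

/-- The coresolution is proper: its augmentation `0 ⟶ N ⟶ Y₀ ⟶ Y₋₁ ⟶ ⋯` is `Hom(-, 𝒴)`-exact, i.e.
`Hom(Y, A) ⟶ Hom(N, A)` is a quasi-isomorphism for each `A` in `𝒴`. -/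
def Coresolution.IsProper {𝒴 : ObjectProperty C} {N : C} (ρ : Coresolution 𝒴 N) : Prop :=
  ∀ A : C, 𝒴 A → QuasiIso
    (((preadditiveYoneda.obj A).mapHomologicalComplex (ComplexShape.down ℤ).symm).map
      ((HomologicalComplex.opFunctor C (ComplexShape.down ℤ)).map ρ.δ.op))

/-- `sup {n ≥ 0 | X_n ≠ 0}`. -/
def Resolution.length {𝒳 : ObjectProperty C} {M : C} (ρ : Resolution 𝒳 M) : ℕ∞ :=
  ⨆ (n : ℕ) (_ : ¬ IsZero (ρ.X.X (n : ℤ))), (n : ℕ∞)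

/-- `sup {n ≥ 0 | Y_{-n} ≠ 0}`. -/
def Coresolution.length {𝒴 : ObjectProperty C} {N : C} (ρ : Coresolution 𝒴 N) : ℕ∞ :=
  ⨆ (n : ℕ) (_ : ¬ IsZero (ρ.Y.X (-(n : ℤ)))), (n : ℕ∞)

/-- The `𝒳`-projective dimension of `M`; it is `⊤` if `M` has no bounded `𝒳`-resolution. -/
def relProjDim (𝒳 : ObjectProperty C) (M : C) : ℕ∞ :=
  ⨅ ρ : Resolution 𝒳 M, ρ.length

/-- The `𝒴`-injective dimension of `N`; it is `⊤` if `N` has no bounded `𝒴`-coresolution. -/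
def relInjDim (𝒴 : ObjectProperty C) (N : C) : ℕ∞ :=
  ⨅ ρ : Coresolution 𝒴 N, ρ.length

/-- Totally `𝒲`-acyclic complexes: exact complexes of objects of `𝒲` that are both
`Hom(𝒲, -)`-exact and `Hom(-, 𝒲)`-exact. -/
structure IsTotallyAcyclic (𝒲 : ObjectProperty C) (T : ChainComplex C ℤ) : Prop where
  mem : ∀ n : ℤ, 𝒲 (T.X n)
  acyclic : T.Acyclic
  homFromExact : IsHomFromExact 𝒲 T
  homToExact : IsHomToExact 𝒲 T

/-- A Tate `𝒲`-resolution `T ⟶ W ⟶ M`. -/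
structure TateResolution (𝒲 : ObjectProperty C) (M : C) where
  T : ChainComplex C ℤ
  W : Resolution 𝒲 M
  α : T ⟶ W.X
  totallyAcyclic : IsTotallyAcyclic 𝒲 T
  isProper : W.IsProper
  isIso : ∃ n₀ : ℤ, ∀ n : ℤ, n₀ ≤ n → IsIso (α.f n)

/-- A Tate `𝒱`-coresolution `N ⟶ V ⟶ S`. -/
structure TateCoresolution (𝒱 : ObjectProperty C) (N : C) where
  S : ChainComplex C ℤ
  V : Coresolution 𝒱 N
  β : V.Y ⟶ S
  totallyAcyclic : IsTotallyAcyclic 𝒱 S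
  isProper : V.IsProper
  isIso : ∃ n₀ : ℤ, ∀ n : ℤ, n ≤ n₀ → IsIso (β.f n)

end Abelian

section Modules

variable {R : Type u} [CommRing R]

/-- Gorenstein projective modules: the modules `Coker (X₁ ⟶ X₀)` for `X` a complete projective
resolution, i.e. an exact and `Hom(-, projective)`-exact complex of projective modules. -/
def gorensteinProjective (R : Type u) [CommRing R] : ObjectProperty (ModuleCat.{u} R) := fun M =>
  ∃ X : ChainComplex (ModuleCat.{u} R) ℤ,
    (∀ n : ℤ, Projective (X.X n)) ∧ X.Acyclic ∧
    IsHomToExact (isProjective (ModuleCat.{u} R)) X ∧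
    Nonempty (M ≅ cokernel (X.d 1 0))

/-- Gorenstein injective modules: the modules `Ker (Y₀ ⟶ Y₋₁)` for `Y` a complete injective
resolution, i.e. an exact and `Hom(injective, -)`-exact complex of injective modules. -/
def gorensteinInjective (R : Type u) [CommRing R] : ObjectProperty (ModuleCat.{u} R) := fun N =>
  ∃ Y : ChainComplex (ModuleCat.{u} R) ℤ,
    (∀ n : ℤ, Injective (Y.X n)) ∧ Y.Acyclic ∧
    IsHomFromExact (isInjective (ModuleCat.{u} R)) Y ∧
    Nonempty (N ≅ kernel (Y.d 0 (-1)))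

/-- The Gorenstein projective dimension of a module. -/
def gorensteinProjDim (M : ModuleCat.{u} R) : ℕ∞ := relProjDim (gorensteinProjective R) M

/-- The Gorenstein injective dimension of a module. -/
def gorensteinInjDim (N : ModuleCat.{u} R) : ℕ∞ := relInjDim (gorensteinInjective R) N

/-- Tate resolutions by projective modules. -/
abbrev TateProjectiveResolution (M : ModuleCat.{u} R) :=
  TateResolution (isProjective (ModuleCat.{u} R)) M

/-- Tate coresolutions by injective modules. -/
abbrev TateInjectiveCoresolution (N : ModuleCat.{u} R) :=
  TateCoresolution (isInjective (ModuleCat.{u} R)) N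

/-- The Tate cohomology module `H_{-n}(Hom_R(T, N))` computed from a Tate projective resolution
`T ⟶ W ⟶ M`. The module `Hom_R(T_n, N)` sits in degree `n` of the complex below. -/
def TateResolution.tateExt {M : ModuleCat.{u} R} (τ : TateProjectiveResolution M)
    (N : ModuleCat.{u} R) (n : ℤ) : ModuleCat.{u} R :=
  ((((linearYoneda R (ModuleCat.{u} R)).obj N).mapHomologicalComplex
    (ComplexShape.down ℤ).symm).obj τ.T.op).homology n

/-- The Tate cohomology module `H_{-n}(Hom_R(M, S))` computed from a Tate injective coresolution
`N ⟶ V ⟶ S`. -/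
def TateCoresolution.tateExt {N : ModuleCat.{u} R} (σ : TateInjectiveCoresolution N)
    (M : ModuleCat.{u} R) (n : ℤ) : ModuleCat.{u} R :=
  ((((linearCoyoneda R (ModuleCat.{u} R)).obj (op M)).mapHomologicalComplex
    (ComplexShape.down ℤ)).obj σ.S).homology (-n)

/-- A commutative ring is Gorenstein if it is noetherian and each of its localizations at a prime
ideal has finite injective dimension as a module over itself. -/
structure IsGorensteinRing (R : Type u) [CommRing R] : Prop where
  isNoetherianRing : IsNoetherianRing R
  injectiveDimension_lt_top : ∀ (p : Ideal R) [p.IsPrime],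
    injectiveDimension (ModuleCat.of (Localization.AtPrime p) (Localization.AtPrime p)) < ⊤

end Modules

end RelTate

end

/-!
Splitting the complexes `T` and `S` into short exact sequences and shifting dimension along them
turns `H^n(Hom(T, N))` into `H^{n+m}(Hom(T, Ker (S_m ⟶ S_{m-1})))` for some `m`, and
`H_{-n}(Hom(M, S))` into `H_m(Hom(Coker (T_{n+m+1} ⟶ T_{n+m}), S))`. Both are the same quotient of
`Hom(Coker (T_{n+m+1} ⟶ T_{n+m}), Ker (S_m ⟶ S_{m-1}))`. As `T` and `S` are unbounded, the shifts
are possible in every degree `n`.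

For the existence of Tate resolutions, the Gorenstein projective objects are closed under
extensions, which shows that an object of finite Gorenstein projective dimension has a Gorenstein
projective syzygy in some projective resolution. Below that syzygy, replace the resolution by
embeddings of Gorenstein projective objects into projective ones; orthogonality to projective
objects extends the identity to a chain map. Tate coresolutions are dual.
-/

universe w

open scoped ZeroObject

noncomputable section

namespace RelTate

section HomComplexes

variable {C : Type u} [Category.{v} C] [Abelian C]

instance preservesHomology_preadditiveCoyoneda (P : C) [Projective P] :
    (preadditiveCoyoneda.obj (op P)).PreservesHomology :=
  Functor.preservesHomology_of_map_exact _ fun S hS => by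
    rw [ShortComplex.ab_exact_iff]
    rintro (x : P ⟶ S.X₂) (hx : x ≫ S.g = 0)
    exact ⟨hS.liftFromProjective x hx, hS.liftFromProjective_comp x hx⟩

instance preservesHomology_preadditiveYoneda (J : C) [Injective J] :
    (preadditiveYoneda.obj J).PreservesHomology :=
  Functor.preservesHomology_of_map_exact _ fun S hS => by
    rw [ShortComplex.ab_exact_iff]
    rintro (x : S.X₂.unop ⟶ J) (hx : S.g.unop ≫ x = 0)
    exact ⟨hS.unop.descToInjective x hx, hS.unop.comp_descToInjective x hx⟩

variable (R : Type w) [Ring R] [Linear R C]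

instance preservesHomology_linearCoyoneda (P : C) [Projective P] :
    ((linearCoyoneda R C).obj (op P)).PreservesHomology :=
  Functor.preservesHomology_of_map_exact _ fun S hS => by
    rw [ShortComplex.moduleCat_exact_iff]
    rintro (x : P ⟶ S.X₂) (hx : x ≫ S.g = 0)
    exact ⟨hS.liftFromProjective x hx, hS.liftFromProjective_comp x hx⟩

instance preservesHomology_linearYoneda (J : C) [Injective J] :
    ((linearYoneda R C).obj J).PreservesHomology :=
  Functor.preservesHomology_of_map_exact _ fun S hS => by
    rw [ShortComplex.moduleCat_exact_iff]
    rintro (x : S.X₂.unop ⟶ J) (hx : S.g.unop ≫ x = 0)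
    exact ⟨hS.unop.descToInjective x hx, hS.unop.comp_descToInjective x hx⟩

/-- The complex of `R`-modules `Hom(A, S)`, for an `R`-linear category. -/
abbrev linHomFrom (A : C) (S : ChainComplex C ℤ) :
    HomologicalComplex (ModuleCat.{v} R) (ComplexShape.down ℤ) :=
  (((linearCoyoneda R C).obj (op A)).mapHomologicalComplex (ComplexShape.down ℤ)).obj S

/-- The complex of `R`-modules `Hom(T, B)`, for an `R`-linear category, with `Hom(T_n, B)` placed
in cohomological degree `n`. -/
abbrev linHomTo (T : ChainComplex C ℤ) (B : C) :
    HomologicalComplex (ModuleCat.{v} R) (ComplexShape.down ℤ).symm :=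
  (((linearYoneda R C).obj B).mapHomologicalComplex (ComplexShape.down ℤ).symm).obj T.op

/-- The morphism `Hom(B, S) ⟶ Hom(A, S)` induced by `f`. -/
abbrev linHomFromMap {A B : C} (f : A ⟶ B) (S : ChainComplex C ℤ) :
    linHomFrom R B S ⟶ linHomFrom R A S :=
  (NatTrans.mapHomologicalComplex ((linearCoyoneda R C).map f.op) _).app S

/-- The morphism `Hom(T, A) ⟶ Hom(T, B)` induced by `f`. -/
abbrev linHomToMap (T : ChainComplex C ℤ) {A B : C} (f : A ⟶ B) :
    linHomTo R T A ⟶ linHomTo R T B :=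
  (NatTrans.mapHomologicalComplex ((linearYoneda R C).map f) _).app T.op

/-- The isomorphism `H_n(Hom(A, S)) ≅ H_n(Hom(B, S))` induced by `A ≅ B`. -/
def homologyLinHomFromIso {A B : C} (e : A ≅ B) (S : ChainComplex C ℤ) (n : ℤ) :
    (linHomFrom R A S).homology n ≅ (linHomFrom R B S).homology n :=
  (HomologicalComplex.homologyFunctor _ _ n).mapIso ((NatIso.mapHomologicalComplex
    ((linearCoyoneda R C).mapIso e.symm.op) (ComplexShape.down ℤ)).app S)

/-- The isomorphism `H^n(Hom(T, A)) ≅ H^n(Hom(T, B))` induced by `A ≅ B`. -/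
def homologyLinHomToIso (T : ChainComplex C ℤ) {A B : C} (e : A ≅ B) (n : ℤ) :
    (linHomTo R T A).homology n ≅ (linHomTo R T B).homology n :=
  (HomologicalComplex.homologyFunctor _ _ n).mapIso ((NatIso.mapHomologicalComplex
    ((linearYoneda R C).mapIso e) (ComplexShape.down ℤ).symm).app T.op)

lemma isZero_homology_linHomFrom (P : C) [Projective P] {S : ChainComplex C ℤ} (hS : S.Acyclic)
    (n : ℤ) : IsZero ((linHomFrom R P S).homology n) :=
  (ShortComplex.exact_iff_isZero_homology _).1 ((hS n).map ((linearCoyoneda R C).obj (op P)))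

lemma isZero_homology_linHomTo {T : ChainComplex C ℤ} (hT : T.Acyclic) (J : C) [Injective J]
    (n : ℤ) : IsZero ((linHomTo R T J).homology n) :=
  (ShortComplex.exact_iff_isZero_homology _).1 ((hT n).op.map ((linearYoneda R C).obj J))

lemma shortExact_linHomFrom {S : ChainComplex C ℤ} (hS : ∀ n, Injective (S.X n))
    {E : ShortComplex C} (hE : E.ShortExact) :
    (ShortComplex.mk (linHomFromMap R E.g S) (linHomFromMap R E.f S) (by
      ext n (x : E.X₃ ⟶ S.X n); change E.f ≫ E.g ≫ x = 0; simp)).ShortExact :=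
  HomologicalComplex.shortExact_of_degreewise_shortExact _ fun n =>
    have := hS n
    have := ((linearYoneda R C).obj (S.X n)).preservesFiniteLimits_of_preservesHomology
    have := ((linearYoneda R C).obj (S.X n)).preservesFiniteColimits_of_preservesHomology
    hE.op.map_of_exact ((linearYoneda R C).obj (S.X n))

lemma shortExact_linHomTo {T : ChainComplex C ℤ} (hT : ∀ n, Projective (T.X n))
    {E : ShortComplex C} (hE : E.ShortExact) :
    (ShortComplex.mk (linHomToMap R T E.f) (linHomToMap R T E.g) (by
      ext n (x : T.X n ⟶ E.X₁); change (x ≫ E.f) ≫ E.g = 0; simp)).ShortExact :=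
  HomologicalComplex.shortExact_of_degreewise_shortExact _ fun n =>
    have := hT n
    have := ((linearCoyoneda R C).obj (op (T.X n))).preservesFiniteLimits_of_preservesHomology
    have := ((linearCoyoneda R C).obj (op (T.X n))).preservesFiniteColimits_of_preservesHomology
    hE.map_of_exact ((linearCoyoneda R C).obj (op (T.X n)))

end HomComplexes

section Syzygies

variable {C : Type u} [Category.{v} C] [Abelian C]

lemma shortExact_opcycles (X : ChainComplex C ℤ) {i j : ℤ} (h : j + 1 = i) (hX : X.ExactAt i) :
    (ShortComplex.mk (X.fromOpcycles i j) (X.pOpcycles j) (by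
      rw [← cancel_epi (X.pOpcycles i)]; simp)).ShortExact := by
  have hij : (ComplexShape.down ℤ).Rel i j := h
  have hmono : Mono (X.fromOpcycles i j) :=
    Preadditive.mono_of_isZero_kernel' _
      (X.homologyIsKernel i j ((ComplexShape.down ℤ).next_eq' hij)) hX.isZero_homology
  refine ShortComplex.ShortExact.mk' ?_ hmono inferInstance
  let S' := ShortComplex.mk (X.d i j) (X.pOpcycles j) (by simp)
  let φ : S' ⟶ ShortComplex.mk (X.fromOpcycles i j) (X.pOpcycles j) (by
      rw [← cancel_epi (X.pOpcycles i)]; simp) :=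
    { τ₁ := X.pOpcycles i, τ₂ := 𝟙 _, τ₃ := 𝟙 _ }
  rw [← ShortComplex.exact_iff_of_epi_of_isIso_of_mono φ]
  exact S'.exact_of_g_is_cokernel
    (X.opcyclesIsCokernel i j ((ComplexShape.down ℤ).prev_eq' hij))

lemma shortExact_cycles (X : ChainComplex C ℤ) {i j : ℤ} (h : j + 1 = i) (hX : X.ExactAt j) :
    (ShortComplex.mk (X.iCycles i) (X.toCycles i j) (by
      rw [← cancel_mono (X.iCycles j)]; simp)).ShortExact := by
  have hij : (ComplexShape.down ℤ).Rel i j := h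
  have hepi : Epi (X.toCycles i j) :=
    Preadditive.epi_of_isZero_cokernel' _
      (X.homologyIsCokernel i j ((ComplexShape.down ℤ).prev_eq' hij)) hX.isZero_homology
  refine ShortComplex.ShortExact.mk' ?_ inferInstance hepi
  let S' := ShortComplex.mk (X.iCycles i) (X.d i j) (by simp)
  let φ : ShortComplex.mk (X.iCycles i) (X.toCycles i j) (by
      rw [← cancel_mono (X.iCycles j)]; simp) ⟶ S' :=
    { τ₁ := 𝟙 _, τ₂ := 𝟙 _, τ₃ := X.iCycles j }
  rw [ShortComplex.exact_iff_of_epi_of_isIso_of_mono φ]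
  exact S'.exact_of_f_is_kernel
    (X.cyclesIsKernel i j ((ComplexShape.down ℤ).next_eq' hij))

lemma isIso_opcyclesMap_of_isIso_f {X Y : ChainComplex C ℤ} (φ : X ⟶ Y) (n : ℤ)
    [IsIso (φ.f n)] [IsIso (φ.f (n + 1))] : IsIso (HomologicalComplex.opcyclesMap φ n) := by
  refine ShortComplex.isIso_opcyclesMap_of_isIso_of_epi' _ ‹_› ?_
  change Epi (φ.f ((ComplexShape.down ℤ).prev n))
  rw [ChainComplex.prev]
  infer_instance

lemma isIso_cyclesMap_of_isIso_f {X Y : ChainComplex C ℤ} (φ : X ⟶ Y) (n : ℤ)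
    [IsIso (φ.f n)] [IsIso (φ.f (n - 1))] : IsIso (HomologicalComplex.cyclesMap φ n) := by
  refine ShortComplex.isIso_cyclesMap_of_isIso_of_mono' _ ‹_› ?_
  change Mono (φ.f ((ComplexShape.down ℤ).next n))
  rw [ChainComplex.next]
  infer_instance

end Syzygies

section Resolutions

variable {C : Type u} [Category.{v} C] [Abelian C]

lemma Resolution.exactAt {𝒳 : ObjectProperty C} {M : C} (ρ : Resolution 𝒳 M) {n : ℤ}
    (hn : 0 < n) : ρ.X.ExactAt n :=
  have := ρ.quasiIso
  (quasiIsoAt_iff_exactAt' ρ.γ n (HomologicalComplex.exactAt_single_obj _ _ _ _ hn.ne')).1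
    inferInstance

lemma Coresolution.exactAt {𝒴 : ObjectProperty C} {N : C} (ρ : Coresolution 𝒴 N) {n : ℤ}
    (hn : n < 0) : ρ.Y.ExactAt n :=
  have := ρ.quasiIso
  (quasiIsoAt_iff_exactAt ρ.δ n (HomologicalComplex.exactAt_single_obj _ _ _ _ hn.ne)).1
    inferInstance

/-- The augmentation identifies `M` with the cokernel of `X₁ ⟶ X₀`. -/
def Resolution.opcyclesIso {𝒳 : ObjectProperty C} {M : C} (ρ : Resolution 𝒳 M) :
    ρ.X.opcycles 0 ≅ M :=
  have := ρ.quasiIso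
  (ρ.X.isoHomologyι 0 (-1) (by simp) ((ρ.isZero (-1) (by simp)).eq_of_tgt _ _)).symm ≪≫
    isoOfQuasiIsoAt ρ.γ 0 ≪≫ HomologicalComplex.singleObjHomologySelfIso _ _ _

/-- The coaugmentation identifies `N` with the kernel of `Y₀ ⟶ Y₋₁`. -/
def Coresolution.cyclesIso {𝒴 : ObjectProperty C} {N : C} (ρ : Coresolution 𝒴 N) :
    ρ.Y.cycles 0 ≅ N :=
  have := ρ.quasiIso
  ρ.Y.isoHomologyπ 1 0 (by simp) ((ρ.isZero 1 (by simp)).eq_of_src _ _) ≪≫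
    (isoOfQuasiIsoAt ρ.δ 0).symm ≪≫ HomologicalComplex.singleObjHomologySelfIso _ _ _

lemma Resolution.projective {M : C} (ρ : Resolution (isProjective C) M) (n : ℤ) :
    Projective (ρ.X.X n) := by
  by_cases hn : 0 ≤ n
  · exact ρ.mem n hn
  · exact (ρ.isZero n (by lia)).projective

lemma Coresolution.injective {N : C} (ρ : Coresolution (isInjective C) N) (n : ℤ) :
    Injective (ρ.Y.X n) := by
  by_cases hn : n ≤ 0
  · exact ρ.mem n hn
  · exact (ρ.isZero n (by lia)).injective

end Resolutions

section DimensionShifting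

variable {C : Type u} [Category.{v} C] [Abelian C] (R : Type w) [Ring R] [Linear R C]

lemma nonempty_homology_linHomFrom_opcycles_iso {X : ChainComplex C ℤ}
    (hX : ∀ n, Projective (X.X n)) {S : ChainComplex C ℤ} (hS : ∀ n, Injective (S.X n))
    (hS' : S.Acyclic) (c : ℤ) {i i' : ℤ} (hi : i ≤ i') (hX' : ∀ n, i < n → X.ExactAt n) :
    Nonempty ((linHomFrom R (X.opcycles i') S).homology (i' - c) ≅
      (linHomFrom R (X.opcycles i) S).homology (i - c)) := by
  induction i', hi using Int.leInduction with
  | base => exact ⟨Iso.refl _⟩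
  | succ j hj ih =>
    obtain ⟨e⟩ := ih
    have := hX j
    have hE := shortExact_linHomFrom R hS (shortExact_opcycles X rfl (hX' (j + 1) (by lia)))
    exact ⟨hE.δIso (j + 1 - c) (j - c) (show j - c + 1 = j + 1 - c by ring)
      (isZero_homology_linHomFrom R _ hS' _) (isZero_homology_linHomFrom R _ hS' _) ≪≫ e⟩

lemma nonempty_homology_linHomTo_cycles_iso {T : ChainComplex C ℤ} (hT : ∀ n, Projective (T.X n))
    (hT' : T.Acyclic) {Y : ChainComplex C ℤ} (hY : ∀ n, Injective (Y.X n)) (c : ℤ) {m m' : ℤ}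
    (hm : m' ≤ m) (hY' : ∀ n, n < m → Y.ExactAt n) :
    Nonempty ((linHomTo R T (Y.cycles m')).homology (m' + c) ≅
      (linHomTo R T (Y.cycles m)).homology (m + c)) := by
  induction m', hm using Int.leInductionDown with
  | base => exact ⟨Iso.refl _⟩
  | pred j hj ih =>
    obtain ⟨e⟩ := ih
    have := hY j
    have hE := shortExact_linHomTo R hT
      (shortExact_cycles Y (sub_add_cancel j 1) (hY' (j - 1) (by lia)))
    exact ⟨hE.δIso (j - 1 + c) (j + c) (show j - 1 + c + 1 = j + c by ring)
      (isZero_homology_linHomTo R hT' _ _) (isZero_homology_linHomTo R hT' _ _) ≪≫ e⟩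

end DimensionShifting

section Balance

lemma nonempty_homology_iso_quotient {R : Type w} [Ring R] (S : ShortComplex (ModuleCat.{v} R))
    {K : Type v} [AddCommGroup K] [Module R K] (ι : K →ₗ[R] S.X₂) (hι : Function.Injective ι)
    (hι' : ∀ x, S.g x = 0 ↔ ∃ y, ι y = x) (L : Submodule R K)
    (hL : ∀ y, y ∈ L ↔ ∃ x, S.f x = ι y) :
    Nonempty (S.homology ≅ ModuleCat.of R (K ⧸ L)) := by
  have hmem : ∀ y, ι y ∈ LinearMap.ker S.g.hom := fun y => (hι' _).2 ⟨y, rfl⟩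
  let e : K ≃ₗ[R] LinearMap.ker S.g.hom := LinearEquiv.ofBijective (ι.codRestrict _ hmem)
    ⟨fun a b h => hι (congrArg Subtype.val h), fun ⟨x, hx⟩ => by
      obtain ⟨y, rfl⟩ := (hι' x).1 hx
      exact ⟨y, rfl⟩⟩
  refine ⟨S.moduleCatHomologyIso ≪≫ (LinearEquiv.toModuleIso
    (Submodule.Quotient.equiv L (LinearMap.range S.moduleCatToCycles) e ?_)).symm⟩
  ext x
  obtain ⟨y, rfl⟩ := e.surjective x
  simp only [Submodule.mem_map_equiv, LinearEquiv.symm_apply_apply, hL, LinearMap.mem_range]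
  exact exists_congr fun x => ⟨fun h => Subtype.ext h, fun h => congrArg Subtype.val h⟩

variable {C : Type u} [Category.{v} C] [Abelian C] (R : Type w) [Ring R] [Linear R C]

lemma nonempty_homology_linHomTo_iso_quotient (T : ChainComplex C ℤ) (B : C) (k : ℤ) :
    Nonempty ((linHomTo R T B).homology k ≅ ModuleCat.of R ((T.opcycles k ⟶ B) ⧸
      LinearMap.range (Linear.leftComp R B (T.fromOpcycles k (k - 1))))) := by
  obtain ⟨e⟩ := nonempty_homology_iso_quotient ((linHomTo R T B).sc' (k - 1) k (k + 1))
    (Linear.leftComp R B (T.pOpcycles k))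
    (fun (f g : T.opcycles k ⟶ B) (h : T.pOpcycles k ≫ f = T.pOpcycles k ≫ g) => by
      rwa [cancel_epi] at h)
    (fun (x : T.X k ⟶ B) =>
      ⟨fun (h : T.d (k + 1) k ≫ x = 0) =>
        ⟨T.descOpcycles x (k + 1) (by simp) h, T.p_descOpcycles x (k + 1) (by simp) h⟩, by
        rintro ⟨y, rfl⟩
        change T.d (k + 1) k ≫ T.pOpcycles k ≫ y = 0
        simp⟩)
    (LinearMap.range (Linear.leftComp R B (T.fromOpcycles k (k - 1))))
    (fun y => exists_congr fun (x : T.X (k - 1) ⟶ B) => by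
      change T.fromOpcycles k (k - 1) ≫ x = y ↔ T.d k (k - 1) ≫ x = T.pOpcycles k ≫ y
      rw [← cancel_epi (T.pOpcycles k)]; simp)
  exact ⟨(linHomTo R T B).homologyIsoSc' (k - 1) k (k + 1)
    (ComplexShape.prev_eq' _ (sub_add_cancel k 1)) (ComplexShape.next_eq' _ rfl) ≪≫ e⟩

lemma nonempty_homology_linHomFrom_iso_quotient (A : C) (S : ChainComplex C ℤ) (m : ℤ) :
    Nonempty ((linHomFrom R A S).homology m ≅ ModuleCat.of R ((A ⟶ S.cycles m) ⧸
      LinearMap.range (Linear.rightComp R A (S.toCycles (m + 1) m)))) := by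
  obtain ⟨e⟩ := nonempty_homology_iso_quotient ((linHomFrom R A S).sc' (m + 1) m (m - 1))
    (Linear.rightComp R A (S.iCycles m))
    (fun (f g : A ⟶ S.cycles m) (h : f ≫ S.iCycles m = g ≫ S.iCycles m) => by
      rwa [cancel_mono] at h)
    (fun (x : A ⟶ S.X m) =>
      ⟨fun (h : x ≫ S.d m (m - 1) = 0) =>
        ⟨S.liftCycles x (m - 1) (by simp) h, S.liftCycles_i x (m - 1) (by simp) h⟩, by
        rintro ⟨y, rfl⟩
        change (y ≫ S.iCycles m) ≫ S.d m (m - 1) = 0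
        simp⟩)
    (LinearMap.range (Linear.rightComp R A (S.toCycles (m + 1) m)))
    (fun y => exists_congr fun (x : A ⟶ S.X (m + 1)) => by
      change x ≫ S.toCycles (m + 1) m = y ↔ x ≫ S.d (m + 1) m = y ≫ S.iCycles m
      rw [← cancel_mono (S.iCycles m)]; simp)
  exact ⟨(linHomFrom R A S).homologyIsoSc' (m + 1) m (m - 1) (by simp) (by simp) ≪≫ e⟩

lemma range_leftComp_eq_range_rightComp {A P I B : C} [Projective P] [Injective I] (f : A ⟶ P)
    [Mono f] (g : I ⟶ B) [Epi g] :
    LinearMap.range (Linear.leftComp R B f) = LinearMap.range (Linear.rightComp R A g) := by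
  ext x
  constructor
  · rintro ⟨y, rfl⟩
    exact ⟨f ≫ Projective.factorThru y g, by simp⟩
  · rintro ⟨y, rfl⟩
    exact ⟨Injective.factorThru y f ≫ g, by simp⟩

/-- Both sides are the quotient of `Hom(Coker (T_{k+1} ⟶ T_k), Ker (S_m ⟶ S_{m-1}))` by the
morphisms extending along `Coker (T_{k+1} ⟶ T_k) ⟶ T_{k-1}`, equivalently lifting along
`S_{m+1} ⟶ Ker (S_m ⟶ S_{m-1})`. -/
lemma nonempty_homology_linHomTo_iso_homology_linHomFrom {T : ChainComplex C ℤ}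
    (hT : ∀ n, Projective (T.X n)) (hT' : T.Acyclic) {S : ChainComplex C ℤ}
    (hS : ∀ n, Injective (S.X n)) (hS' : S.Acyclic) (k m : ℤ) :
    Nonempty ((linHomTo R T (S.cycles m)).homology k ≅
      (linHomFrom R (T.opcycles k) S).homology m) := by
  have := (shortExact_opcycles T (sub_add_cancel k 1) (hT' k)).mono_f
  have := (shortExact_cycles S rfl (hS' m)).epi_g
  have := hT (k - 1)
  have := hS (m + 1)
  obtain ⟨e⟩ := nonempty_homology_linHomTo_iso_quotient R T (S.cycles m) k
  obtain ⟨e'⟩ := nonempty_homology_linHomFrom_iso_quotient R (T.opcycles k) S m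
  rw [← range_leftComp_eq_range_rightComp R (T.fromOpcycles k (k - 1))] at e'
  exact ⟨e ≪≫ e'.symm⟩

end Balance

section TateComparison

variable {C : Type u} [Category.{v} C] [Abelian C] (R : Type w) [Ring R] [Linear R C]

lemma TateResolution.nonempty_homology_linHomFrom_opcycles_iso {M : C}
    (τ : TateResolution (isProjective C) M) {S : ChainComplex C ℤ} (hS : ∀ n, Injective (S.X n))
    (hS' : S.Acyclic) (k c : ℤ) :
    Nonempty ((linHomFrom R (τ.T.opcycles k) S).homology (k - c) ≅
      (linHomFrom R M S).homology (-c)) := by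
  obtain ⟨n₀, h₀⟩ := τ.isIso
  obtain ⟨a, hk, ha, hn₀⟩ : ∃ a, k ≤ a ∧ 0 ≤ a ∧ n₀ ≤ a := ⟨max k (max 0 n₀), by simp⟩
  have := h₀ a hn₀
  have := h₀ (a + 1) (by lia)
  have := isIso_opcyclesMap_of_isIso_f τ.α a
  obtain ⟨e₁⟩ := RelTate.nonempty_homology_linHomFrom_opcycles_iso R τ.totallyAcyclic.mem hS hS' c
    hk fun n _ => τ.totallyAcyclic.acyclic n
  obtain ⟨e₂⟩ := RelTate.nonempty_homology_linHomFrom_opcycles_iso R τ.W.projective hS hS' c ha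
    fun n hn => τ.W.exactAt hn
  rw [zero_sub] at e₂
  exact ⟨e₁.symm ≪≫ homologyLinHomFromIso R (asIso (HomologicalComplex.opcyclesMap τ.α a)) S _ ≪≫
    e₂ ≪≫ homologyLinHomFromIso R τ.W.opcyclesIso S _⟩

lemma TateCoresolution.exists_homology_linHomTo_cycles_iso {N : C}
    (σ : TateCoresolution (isInjective C) N) {T : ChainComplex C ℤ}
    (hT : ∀ n, Projective (T.X n)) (hT' : T.Acyclic) (c : ℤ) :
    ∃ m, Nonempty ((linHomTo R T (σ.S.cycles m)).homology (m + c) ≅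
      (linHomTo R T N).homology c) := by
  obtain ⟨n₀, h₀⟩ := σ.isIso
  obtain ⟨b, hb, hn₀⟩ : ∃ b, b ≤ 0 ∧ b ≤ n₀ := ⟨min 0 n₀, by simp⟩
  have := h₀ b hn₀
  have := h₀ (b - 1) (by lia)
  have := isIso_cyclesMap_of_isIso_f σ.β b
  obtain ⟨e⟩ := RelTate.nonempty_homology_linHomTo_cycles_iso R hT hT' σ.V.injective c hb
    fun n hn => σ.V.exactAt hn
  rw [zero_add] at e
  exact ⟨b, ⟨homologyLinHomToIso R T (asIso (HomologicalComplex.cyclesMap σ.β b)).symm _ ≪≫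
    e ≪≫ homologyLinHomToIso R T σ.V.cyclesIso _⟩⟩

lemma nonempty_homology_linHomTo_iso_linHomFrom {M N : C} (τ : TateResolution (isProjective C) M)
    (σ : TateCoresolution (isInjective C) N) (n : ℤ) :
    Nonempty ((linHomTo R τ.T N).homology n ≅ (linHomFrom R M σ.S).homology (-n)) := by
  have hT := τ.totallyAcyclic.mem
  have hS := σ.totallyAcyclic.mem
  obtain ⟨m, ⟨e₁⟩⟩ :=
    σ.exists_homology_linHomTo_cycles_iso R hT τ.totallyAcyclic.acyclic n
  obtain ⟨e₂⟩ := nonempty_homology_linHomTo_iso_homology_linHomFrom R hT τ.totallyAcyclic.acyclic hS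
    σ.totallyAcyclic.acyclic (m + n) m
  obtain ⟨e₃⟩ := τ.nonempty_homology_linHomFrom_opcycles_iso R hS σ.totallyAcyclic.acyclic (m + n) n
  rw [add_sub_cancel_right] at e₃
  exact ⟨e₁.symm ≪≫ e₂ ≪≫ e₃⟩

end TateComparison

section ShortExactSequences

variable {C : Type u} [Category.{v} C] [Abelian C]

lemma shortExact_of_isos {S : ShortComplex C} (hS : S.ShortExact) {A B : C} (a : A ≅ S.X₁)
    (b : S.X₃ ≅ B) : (ShortComplex.mk (a.hom ≫ S.f) (S.g ≫ b.hom) (by simp)).ShortExact :=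
  ShortComplex.shortExact_of_iso (ShortComplex.isoMk a.symm (Iso.refl _) b) hS

lemma shortExact_pullback {S : ShortComplex C} (hS : S.ShortExact) {D : C} (f : D ⟶ S.X₃) :
    (ShortComplex.mk (pullback.lift S.f 0 (by simp) : S.X₁ ⟶ pullback S.g f)
      (pullback.snd S.g f) (pullback.lift_snd _ _ _)).ShortExact := by
  have := hS.mono_f
  have := hS.epi_g
  have hmono : Mono (pullback.lift S.f 0 (by simp) : S.X₁ ⟶ pullback S.g f) :=
    mono_of_mono_fac (pullback.lift_fst _ _ _)
  refine .mk' (ShortComplex.exact_of_f_is_kernel _ ?_) hmono inferInstance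
  refine KernelFork.IsLimit.ofι' _ _ fun {A} k (hk : k ≫ pullback.snd S.g f = 0) => ?_
  have h : (k ≫ pullback.fst S.g f) ≫ S.g = 0 := by
    rw [Category.assoc, pullback.condition, reassoc_of% hk, zero_comp]
  exact ⟨hS.exact.lift _ h, pullback.hom_ext
    ((Category.assoc _ _ _).trans ((congrArg _ (pullback.lift_fst _ _ _)).trans
      (hS.exact.lift_f _ h)))
    ((Category.assoc _ _ _).trans ((congrArg _ (pullback.lift_snd _ _ _)).trans
      (comp_zero.trans hk.symm)))⟩

lemma shortExact_pullback_comp {S : ShortComplex C} [Epi S.g] {D Z : C}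
    (f : D ⟶ S.X₃) (r : S.X₃ ⟶ Z) (w : f ≫ r = 0) (h : (ShortComplex.mk f r w).ShortExact) :
    (ShortComplex.mk (pullback.fst S.g f) (S.g ≫ r)
      (by rw [pullback.condition_assoc, w, comp_zero])).ShortExact := by
  have : Mono f := h.mono_f
  have : Epi r := h.epi_g
  refine .mk' (ShortComplex.exact_of_f_is_kernel _ ?_) inferInstance (epi_comp _ _)
  refine KernelFork.IsLimit.ofι' _ _ fun {A} k (hk : k ≫ S.g ≫ r = 0) => ?_
  have hk' : (k ≫ S.g) ≫ r = 0 := by rw [Category.assoc, hk]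
  exact ⟨pullback.lift k (h.exact.lift _ hk') (h.exact.lift_f _ hk').symm, pullback.lift_fst _ _ _⟩

/-- The snake diagram of a morphism of short exact sequences. -/
def snakeInput {S S' : ShortComplex C} (hS : S.ShortExact) (hS' : S'.ShortExact)
    (φ : S ⟶ S') : ShortComplex.SnakeInput C where
  L₀ := kernel φ
  L₁ := S
  L₂ := S'
  L₃ := cokernel φ
  v₀₁ := kernel.ι φ
  v₁₂ := φ
  v₂₃ := cokernel.π φ
  w₀₂ := kernel.condition φ
  w₁₃ := cokernel.condition φ
  h₀ := kernelIsKernel φ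
  h₃ := cokernelIsCokernel φ
  L₁_exact := hS.exact
  epi_L₁_g := hS.epi_g
  L₂_exact := hS'.exact
  mono_L₂_f := hS'.mono_f

lemma shortExact_snakeInput_L₀ (D : ShortComplex.SnakeInput C) (h₁ : Mono D.L₁.f)
    (h : Epi D.v₁₂.τ₁) : D.L₀.ShortExact := by
  have hz : IsZero D.L₃.X₁ := by
    rw [IsZero.iff_id_eq_zero, ← cancel_epi D.v₂₃.τ₁, zero_of_epi_comp _ D.w₁₃_τ₁, zero_comp,
      zero_comp]
  exact .mk' D.L₀_exact inferInstance (D.L₁'_exact.epi_f (hz.eq_of_tgt _ _))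

lemma shortExact_snakeInput_L₃ (D : ShortComplex.SnakeInput C) (h₂ : Epi D.L₂.g)
    (h : Mono D.v₁₂.τ₃) : D.L₃.ShortExact := by
  have hz : IsZero D.L₀.X₃ := by
    rw [IsZero.iff_id_eq_zero, ← cancel_mono D.v₀₁.τ₃, zero_of_comp_mono _ D.w₀₂_τ₃, comp_zero,
      comp_zero]
  exact .mk' D.L₃_exact (D.L₂'_exact.mono_g (hz.eq_of_src _ _)) inferInstance

end ShortExactSequences

section Syzygy

variable {C : Type u} [Category.{v} C] [Abelian C]

/-- `A` is a syzygy of `B`: the kernel of an epimorphism from a projective object to `B`. -/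
def IsSyzygy (A B : C) : Prop :=
  ∃ (P : C) (i : A ⟶ P) (p : P ⟶ B) (w : i ≫ p = 0),
    Projective P ∧ (ShortComplex.mk i p w).ShortExact

lemma IsSyzygy.of_isos {A A' B B' : C} (h : IsSyzygy A B) (a : A' ≅ A) (b : B ≅ B') :
    IsSyzygy A' B' := by
  obtain ⟨P, i, p, w, hP, h⟩ := h
  exact ⟨P, _, _, _, hP, shortExact_of_isos h a b⟩

lemma IsSyzygy.exists_extension {S : ShortComplex C} (hS : S.ShortExact) {A : C}
    (hA : IsSyzygy A S.X₂) :
    ∃ (L : C) (i : A ⟶ L) (p : L ⟶ S.X₁) (w : i ≫ p = 0),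
      (ShortComplex.mk i p w).ShortExact ∧ IsSyzygy L S.X₃ := by
  obtain ⟨P, j, q, wP, hP, hA⟩ := hA
  have : Epi q := hA.epi_g
  exact ⟨pullback q S.f, _, _, _, shortExact_pullback hA S.f,
    P, _, _, _, hP, shortExact_pullback_comp (S := .mk j q wP) S.f S.g S.zero hS⟩

lemma IsSyzygy.horseshoe {S : ShortComplex C} (hS : S.ShortExact) {A B : C}
    (hA : IsSyzygy A S.X₁) (hB : IsSyzygy B S.X₃) :
    ∃ (K : C) (i : A ⟶ K) (p : K ⟶ B) (w : i ≫ p = 0),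
      (ShortComplex.mk i p w).ShortExact ∧ IsSyzygy K S.X₂ := by
  obtain ⟨P, j, q, wP, hP, hA⟩ := hA
  obtain ⟨Q, k, r, wQ, hQ, hB⟩ := hB
  have := hS.epi_g
  have hPQ := (ShortComplex.Splitting.ofHasBinaryBiproduct P Q).shortExact
  let φ : ShortComplex.mk (biprod.inl : P ⟶ P ⊞ Q) biprod.snd (by simp) ⟶ S :=
    { τ₁ := q
      τ₂ := biprod.desc (q ≫ S.f) (Projective.factorThru r S.g)
      τ₃ := r
      comm₁₂ := by simp
      comm₂₃ := by ext <;> simp }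
  let D := snakeInput hPQ hS φ
  have h₁ : Epi φ.τ₁ := hA.epi_g
  have h₃ : Epi φ.τ₃ := hB.epi_g
  have h₂ : Epi φ.τ₂ := ShortComplex.epi_τ₂_of_exact_of_epi φ hS.exact
  have e₁ := ShortComplex.ShortExact.mk' D.exact_C₁_up (inferInstanceAs (Mono D.v₀₁.τ₁)) h₁
  have e₂ := ShortComplex.ShortExact.mk' D.exact_C₂_up (inferInstanceAs (Mono D.v₀₁.τ₂)) h₂
  have e₃ := ShortComplex.ShortExact.mk' D.exact_C₃_up (inferInstanceAs (Mono D.v₀₁.τ₃)) h₃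
  exact ⟨_, _, _, _, shortExact_of_isos (shortExact_snakeInput_L₀ D hPQ.mono_f h₁)
    (hA.fIsKernel.conePointUniqueUpToIso e₁.fIsKernel)
    (e₃.fIsKernel.conePointUniqueUpToIso hB.fIsKernel),
    _, _, _, _, inferInstanceAs (Projective (P ⊞ Q)), e₂⟩

variable [HasExt.{w} C]

/-- Left orthogonality to the projective objects: `Ext¹(B, Q) = 0` for `Q` projective. -/
def IsLeftOrthogonal (B : C) : Prop :=
  ∀ Q : C, Projective Q → Subsingleton (Abelian.Ext B Q 1)

lemma isLeftOrthogonal_of_projective (P : C) [Projective P] : IsLeftOrthogonal P :=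
  fun Q _ => Abelian.Ext.subsingleton_of_projective P Q 0

lemma IsLeftOrthogonal.of_iso {A B : C} (hA : IsLeftOrthogonal A) (e : A ≅ B) :
    IsLeftOrthogonal B := fun Q hQ =>
  have := hA Q hQ
  ⟨fun x y => by
    rw [← Abelian.Ext.mk₀_id_comp x, ← Abelian.Ext.mk₀_id_comp y, ← e.inv_hom_id,
      ← Abelian.Ext.mk₀_comp_mk₀_assoc, ← Abelian.Ext.mk₀_comp_mk₀_assoc,
      Subsingleton.elim ((Abelian.Ext.mk₀ e.hom).comp x (zero_add 1))]⟩

lemma IsLeftOrthogonal.of_extension {S : ShortComplex C} (hS : S.ShortExact)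
    (h₁ : IsLeftOrthogonal S.X₁) (h₃ : IsLeftOrthogonal S.X₃) : IsLeftOrthogonal S.X₂ := by
  refine fun Q hQ => subsingleton_of_forall_eq 0 fun x => ?_
  have := h₁ Q hQ
  have := h₃ Q hQ
  obtain ⟨y, rfl⟩ := Abelian.Ext.contravariant_sequence_exact₂ hS Q x (Subsingleton.elim _ _)
  rw [Subsingleton.elim y 0, Abelian.Ext.comp_zero]

lemma IsLeftOrthogonal.exists_extension {S : ShortComplex C} (hS : S.ShortExact)
    (h : IsLeftOrthogonal S.X₃) {Q : C} (hQ : Projective Q) (f : S.X₁ ⟶ Q) :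
    ∃ g : S.X₂ ⟶ Q, S.f ≫ g = f := by
  have := h Q hQ
  obtain ⟨x, hx⟩ := Abelian.Ext.contravariant_sequence_exact₁ hS Q (Abelian.Ext.mk₀ f)
    (add_zero 1) (Subsingleton.elim _ _)
  obtain ⟨g, rfl⟩ := (Abelian.Ext.mk₀_bijective _ _).2 x
  exact ⟨g, (Abelian.Ext.mk₀_bijective _ _).1 (by rw [← hx, Abelian.Ext.mk₀_comp_mk₀])⟩

lemma isLeftOrthogonal_of_presentation {S : ShortComplex C} (hS : S.ShortExact)
    (hP : Projective S.X₂)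
    (h : ∀ Q : C, Projective Q → ∀ f : S.X₁ ⟶ Q, ∃ g : S.X₂ ⟶ Q, S.f ≫ g = f) :
    IsLeftOrthogonal S.X₃ := by
  refine fun Q hQ => subsingleton_of_forall_eq 0 fun x => ?_
  obtain ⟨y, rfl⟩ := Abelian.Ext.contravariant_sequence_exact₃ hS Q x
    (Abelian.Ext.eq_zero_of_projective _) (add_zero 1)
  obtain ⟨f, rfl⟩ := (Abelian.Ext.mk₀_bijective _ _).2 y
  obtain ⟨g, rfl⟩ := h Q hQ f
  rw [← Abelian.Ext.mk₀_comp_mk₀, hS.extClass_comp_assoc]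

lemma IsSyzygy.cohorseshoe {S : ShortComplex C} (hS : S.ShortExact)
    (h : IsLeftOrthogonal S.X₃) {A B : C} (hA : IsSyzygy S.X₁ A) (hB : IsSyzygy S.X₃ B) :
    ∃ (K : C) (i : A ⟶ K) (p : K ⟶ B) (w : i ≫ p = 0),
      (ShortComplex.mk i p w).ShortExact ∧ IsSyzygy S.X₂ K := by
  obtain ⟨P, j, q, wP, hP, hA⟩ := hA
  obtain ⟨Q, k, r, wQ, hQ, hB⟩ := hB
  obtain ⟨g, hg⟩ := h.exists_extension hS hP j
  have := hS.mono_f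
  have hPQ := (ShortComplex.Splitting.ofHasBinaryBiproduct P Q).shortExact
  let φ : S ⟶ ShortComplex.mk (biprod.inl : P ⟶ P ⊞ Q) biprod.snd (by simp) :=
    { τ₁ := j
      τ₂ := biprod.lift g (S.g ≫ k)
      τ₃ := k
      comm₁₂ := by ext <;> simp [hg]
      comm₂₃ := by simp }
  let D := snakeInput hS hPQ φ
  have h₁ : Mono φ.τ₁ := hA.mono_f
  have h₃ : Mono φ.τ₃ := hB.mono_f
  have h₂ : Mono φ.τ₂ := ShortComplex.mono_τ₂_of_exact_of_mono φ hS.exact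
  have e₁ := ShortComplex.ShortExact.mk' D.exact_C₁_down h₁ (inferInstanceAs (Epi D.v₂₃.τ₁))
  have e₂ := ShortComplex.ShortExact.mk' D.exact_C₂_down h₂ (inferInstanceAs (Epi D.v₂₃.τ₂))
  have e₃ := ShortComplex.ShortExact.mk' D.exact_C₃_down h₃ (inferInstanceAs (Epi D.v₂₃.τ₃))
  exact ⟨_, _, _, _, shortExact_of_isos (shortExact_snakeInput_L₃ D hPQ.epi_g h₃)
    (hA.gIsCokernel.coconePointUniqueUpToIso e₁.gIsCokernel)
    (e₃.gIsCokernel.coconePointUniqueUpToIso hB.gIsCokernel),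
    _, _, _, _, inferInstanceAs (Projective (P ⊞ Q)), e₂⟩

end Syzygy

section GorensteinProjective

variable {C : Type u} [Category.{v} C] [Abelian C] [HasExt.{w} C]

/-- A class of objects left orthogonal to the projective objects in which every object has a
syzygy and is a syzygy. -/
structure IsGorensteinProjectiveClass (𝒢 : ObjectProperty C) : Prop where
  exists_syzygy : ∀ B, 𝒢 B → ∃ A, 𝒢 A ∧ IsSyzygy A B
  exists_cosyzygy : ∀ A, 𝒢 A → ∃ B, 𝒢 B ∧ IsSyzygy A B
  orthogonal : ∀ B, 𝒢 B → IsLeftOrthogonal B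

variable (C) in
/-- The Gorenstein projective objects, defined coinductively as the largest Gorenstein projective
class, so that membership is proved without assembling a totally acyclic complex. -/
def gproj : ObjectProperty C := fun G => ∃ 𝒢, IsGorensteinProjectiveClass 𝒢 ∧ 𝒢 G

variable (C) in
lemma isGorensteinProjectiveClass_gproj : IsGorensteinProjectiveClass (gproj C) where
  exists_syzygy := fun B ⟨𝒢, h𝒢, hB⟩ =>
    (h𝒢.exists_syzygy B hB).imp fun _ ⟨hA, h⟩ => ⟨⟨𝒢, h𝒢, hA⟩, h⟩
  exists_cosyzygy := fun B ⟨𝒢, h𝒢, hB⟩ =>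
    (h𝒢.exists_cosyzygy B hB).imp fun _ ⟨hA, h⟩ => ⟨⟨𝒢, h𝒢, hA⟩, h⟩
  orthogonal := fun B ⟨_, h𝒢, hB⟩ => h𝒢.orthogonal B hB

lemma IsGorensteinProjectiveClass.isoClosure {𝒢 : ObjectProperty C}
    (h : IsGorensteinProjectiveClass 𝒢) : IsGorensteinProjectiveClass 𝒢.isoClosure where
  exists_syzygy := by
    rintro X ⟨Y, hY, ⟨e⟩⟩
    obtain ⟨Z, hZ, hZY⟩ := h.exists_syzygy Y hY
    exact ⟨Z, 𝒢.le_isoClosure Z hZ, hZY.of_isos (Iso.refl _) e.symm⟩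
  exists_cosyzygy := by
    rintro X ⟨Y, hY, ⟨e⟩⟩
    obtain ⟨Z, hZ, hYZ⟩ := h.exists_cosyzygy Y hY
    exact ⟨Z, 𝒢.le_isoClosure Z hZ, hYZ.of_isos e (Iso.refl _)⟩
  orthogonal := by
    rintro X ⟨Y, hY, ⟨e⟩⟩
    exact (h.orthogonal Y hY).of_iso e.symm

lemma gproj_of_iso {A B : C} (e : A ≅ B) (hA : gproj C A) : gproj C B :=
  ⟨_, (isGorensteinProjectiveClass_gproj C).isoClosure, A, hA, ⟨e.symm⟩⟩

lemma isGorensteinProjectiveClass_isProjective :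
    IsGorensteinProjectiveClass (isProjective C) where
  exists_syzygy B hB := ⟨0, inferInstanceAs (Projective (0 : C)), B, 0, 𝟙 B, by simp, hB,
    (ShortComplex.Splitting.ofIsZeroOfIsIso (.mk 0 (𝟙 B) (by simp)) (isZero_zero C)
      inferInstance).shortExact⟩
  exists_cosyzygy A hA := ⟨0, inferInstanceAs (Projective (0 : C)), A, 𝟙 A, 0, by simp, hA,
    (ShortComplex.Splitting.ofIsIsoOfIsZero (.mk (𝟙 A) 0 (by simp)) inferInstance
      (isZero_zero C)).shortExact⟩
  orthogonal B hB := have : Projective B := hB; isLeftOrthogonal_of_projective B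

lemma gproj_of_projective (P : C) [hP : Projective P] : gproj C P :=
  ⟨_, isGorensteinProjectiveClass_isProjective, hP⟩

lemma gproj_of_extension {S : ShortComplex C} (hS : S.ShortExact) (h₁ : gproj C S.X₁)
    (h₃ : gproj C S.X₃) : gproj C S.X₂ := by
  have h := isGorensteinProjectiveClass_gproj C
  refine ⟨fun X => ∃ (A B : C) (i : A ⟶ X) (p : X ⟶ B) (w : i ≫ p = 0),
    (ShortComplex.mk i p w).ShortExact ∧ gproj C A ∧ gproj C B, ⟨?_, ?_, ?_⟩,
    _, _, _, _, _, hS, h₁, h₃⟩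
  · rintro X ⟨A, B, i, p, w, hX, hA, hB⟩
    obtain ⟨A', hA', hAA'⟩ := h.exists_syzygy A hA
    obtain ⟨B', hB', hBB'⟩ := h.exists_syzygy B hB
    obtain ⟨K, i', p', w', hK, hKX⟩ := IsSyzygy.horseshoe hX hAA' hBB'
    exact ⟨K, ⟨A', B', i', p', w', hK, hA', hB'⟩, hKX⟩
  · rintro X ⟨A, B, i, p, w, hX, hA, hB⟩
    obtain ⟨A', hA', hAA'⟩ := h.exists_cosyzygy A hA
    obtain ⟨B', hB', hBB'⟩ := h.exists_cosyzygy B hB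
    obtain ⟨K, i', p', w', hK, hXK⟩ := IsSyzygy.cohorseshoe hX (h.orthogonal B hB) hAA' hBB'
    exact ⟨K, ⟨A', B', i', p', w', hK, hA', hB'⟩, hXK⟩
  · rintro X ⟨A, B, i, p, w, hX, hA, hB⟩
    exact .of_extension hX (h.orthogonal A hA) (h.orthogonal B hB)

lemma gproj_of_int_sequence {Z P : ℤ → C} (hP : ∀ n, Projective (P n))
    (i : ∀ n, Z (n + 1) ⟶ P n) (p : ∀ n, P n ⟶ Z n) (w : ∀ n, i n ≫ p n = 0)
    (h : ∀ n, (ShortComplex.mk (i n) (p n) (w n)).ShortExact)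
    (hext : ∀ (n : ℤ) (Q : C), Projective Q → ∀ f : Z (n + 1) ⟶ Q, ∃ g : P n ⟶ Q, i n ≫ g = f)
    (n : ℤ) : gproj C (Z n) := by
  refine ⟨fun X => ∃ n, X = Z n, ⟨?_, ?_, ?_⟩, n, rfl⟩
  · rintro _ ⟨n, rfl⟩
    exact ⟨_, ⟨_, rfl⟩, _, _, _, w n, hP n, h n⟩
  · rintro _ ⟨n, rfl⟩
    obtain ⟨m, rfl⟩ : ∃ m, n = m + 1 := ⟨n - 1, by simp⟩
    exact ⟨_, ⟨m, rfl⟩, _, _, _, w m, hP m, h m⟩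
  · rintro _ ⟨n, rfl⟩
    exact isLeftOrthogonal_of_presentation (h n) (hP n) (hext n)

/-- Objects with a Gorenstein projective `d`-th syzygy. -/
def HasGprojSyzygy : ℕ → ObjectProperty C
  | 0 => gproj C
  | d + 1 => fun M => ∃ K, HasGprojSyzygy d K ∧ IsSyzygy K M

lemma HasGprojSyzygy.of_iso {d : ℕ} {A B : C} (h : HasGprojSyzygy d A) (e : A ≅ B) :
    HasGprojSyzygy d B := by
  cases d with
  | zero => exact gproj_of_iso e h
  | succ d => exact h.imp fun _ ⟨hK, hKA⟩ => ⟨hK, hKA.of_isos (Iso.refl _) e⟩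

lemma HasGprojSyzygy.exists_syzygy {d : ℕ} {M : C} (h : HasGprojSyzygy d M) :
    ∃ K, HasGprojSyzygy (d - 1) K ∧ IsSyzygy K M := by
  cases d with
  | zero => exact (isGorensteinProjectiveClass_gproj C).exists_syzygy M h
  | succ d => exact h

/-- The syzygy of the cokernel is an extension of `S.X₁` by a syzygy of `S.X₂`. -/
lemma HasGprojSyzygy.cokernel {d : ℕ} {S : ShortComplex C} (hS : S.ShortExact)
    (h₁ : HasGprojSyzygy d S.X₁) (h₂ : gproj C S.X₂) : HasGprojSyzygy (d + 1) S.X₃ := by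
  have h := isGorensteinProjectiveClass_gproj C
  induction d generalizing S with
  | zero =>
    obtain ⟨G, hG, hGS⟩ := h.exists_syzygy _ h₂
    obtain ⟨L, i, p, w, hL, hLS⟩ := hGS.exists_extension hS
    exact ⟨L, gproj_of_extension hL hG h₁, hLS⟩
  | succ d ih =>
    obtain ⟨G, hG, hGS⟩ := h.exists_syzygy _ h₂
    obtain ⟨L, i, p, w, hL, hLS⟩ := hGS.exists_extension hS
    obtain ⟨K, hK, Q, k, r, wQ, hQ, hKQ⟩ := h₁
    have hE : gproj C (pullback r p) := gproj_of_iso (pullbackSymmetry _ _)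
      (gproj_of_extension (shortExact_pullback hL r) hG (gproj_of_projective Q))
    exact ⟨L, ih (shortExact_pullback hKQ p) hK hE, hLS⟩

lemma hasGprojSyzygy_of_sequence {Z G : ℕ → C} (hG : ∀ n, gproj C (G n))
    (i : ∀ n, Z (n + 1) ⟶ G n) (p : ∀ n, G n ⟶ Z n) (w : ∀ n, i n ≫ p n = 0)
    (h : ∀ n, (ShortComplex.mk (i n) (p n) (w n)).ShortExact) {d : ℕ} (hd : IsZero (Z d)) :
    HasGprojSyzygy d (Z 0) := by
  induction d generalizing Z G with
  | zero => exact gproj_of_iso hd.isoZero.symm (gproj_of_projective 0)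
  | succ d ih => exact .cokernel (h 0) (ih (fun n => hG (n + 1)) (fun n => i (n + 1))
      (fun n => p (n + 1)) (fun n => w (n + 1)) (fun n => h (n + 1)) hd) (hG 0)

end GorensteinProjective

section HomExactness

variable {C : Type u} [Category.{v} C] [Abelian C]

lemma homFrom_exactAt_iff (A : C) (X : ChainComplex C ℤ) {i j k : ℤ} (hi : j + 1 = i)
    (hk : k + 1 = j) : (homFrom A X).ExactAt j ↔
      ∀ f : A ⟶ X.X j, f ≫ X.d j k = 0 → ∃ g : A ⟶ X.X i, g ≫ X.d i j = f := by
  rw [HomologicalComplex.exactAt_iff' _ i j k (ComplexShape.prev_eq' _ hi)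
    (ComplexShape.next_eq' _ hk), ShortComplex.ab_exact_iff]
  rfl

lemma homTo_exactAt_iff (A : C) (X : ChainComplex C ℤ) {i j k : ℤ} (hi : j + 1 = i)
    (hk : k + 1 = j) : (homTo X A).ExactAt j ↔
      ∀ f : X.X j ⟶ A, X.d i j ≫ f = 0 → ∃ g : X.X k ⟶ A, X.d j k ≫ g = f := by
  rw [HomologicalComplex.exactAt_iff' _ k j i (ComplexShape.prev_eq' _ hk)
    (ComplexShape.next_eq' _ hi), ShortComplex.ab_exact_iff]
  rfl

lemma isHomFromExact_isProjective {X : ChainComplex C ℤ} (hX : X.Acyclic) :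
    IsHomFromExact (isProjective C) X := fun P (_ : Projective P) n =>
  (hX n).map (preadditiveCoyoneda.obj (op P))

lemma isHomToExact_isInjective {X : ChainComplex C ℤ} (hX : X.Acyclic) :
    IsHomToExact (isInjective C) X := fun J (_ : Injective J) n =>
  (hX n).op.map (preadditiveYoneda.obj J)

end HomExactness

section TotallyAcyclic

variable {C : Type u} [Category.{v} C] [Abelian C]

variable (C) in
/-- Gorenstein projective objects, in the formulation of `gorensteinProjective`. -/
def gorensteinProjectiveObject : ObjectProperty C := fun M =>
  ∃ X : ChainComplex C ℤ, (∀ n, Projective (X.X n)) ∧ X.Acyclic ∧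
    IsHomToExact (isProjective C) X ∧ Nonempty (M ≅ cokernel (X.d 1 0))

variable (C) in
/-- Gorenstein injective objects, in the formulation of `gorensteinInjective`. -/
def gorensteinInjectiveObject : ObjectProperty C := fun N =>
  ∃ Y : ChainComplex C ℤ, (∀ n, Injective (Y.X n)) ∧ Y.Acyclic ∧
    IsHomFromExact (isInjective C) Y ∧ Nonempty (N ≅ kernel (Y.d 0 (-1)))

lemma gproj_opcycles [HasExt.{w} C] {X : ChainComplex C ℤ} (hX : ∀ n, Projective (X.X n))
    (hX' : X.Acyclic) (h : IsHomToExact (isProjective C) X) (n : ℤ) : gproj C (X.opcycles n) := by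
  refine gproj_of_int_sequence (Z := fun n => X.opcycles n) hX _ _ _
    (fun n => shortExact_opcycles X rfl (hX' (n + 1)))
    (fun n Q hQ f => ?_) n
  obtain ⟨g, hg⟩ := (homTo_exactAt_iff Q X (j := n + 1) rfl rfl).1 (h Q hQ _)
    (X.pOpcycles (n + 1) ≫ f) (by simp)
  exact ⟨g, by rw [← cancel_epi (X.pOpcycles (n + 1)), ← hg]; simp⟩

lemma gproj_op_cycles [HasExt.{w} Cᵒᵖ] {Y : ChainComplex C ℤ} (hY : ∀ n, Injective (Y.X n))
    (hY' : Y.Acyclic) (h : IsHomFromExact (isInjective C) Y) (n : ℤ) :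
    gproj Cᵒᵖ (op (Y.cycles n)) := by
  suffices ∀ n, gproj Cᵒᵖ (op (Y.cycles (-n))) by simpa using this (-n)
  refine gproj_of_int_sequence (Z := fun n => op (Y.cycles (-n)))
    (fun n => have := hY (-n); inferInstanceAs (Projective (op (Y.X (-n))))) _ _ _
    (fun n => (shortExact_cycles Y (i := -n) (j := -(n + 1)) (by ring) (hY' _)).op)
    fun n Q hQ f => ?_
  obtain ⟨g, hg⟩ := (homFrom_exactAt_iff Q.unop Y (i := -n) (j := -(n + 1)) (by ring)
    (sub_add_cancel _ 1)).1 (h _ (inferInstanceAs (Injective Q.unop)) _)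
    (f.unop ≫ Y.iCycles _) ((Category.assoc _ _ _).trans (by simp))
  have hg' : g ≫ Y.toCycles (-n) (-(n + 1)) = f.unop := by
    rw [← cancel_mono (Y.iCycles _), ← hg]
    simp
  exact ⟨g.op, congrArg Quiver.Hom.op hg'⟩

lemma gproj_of_gorensteinProjectiveObject [HasExt.{w} C] {M : C}
    (hM : gorensteinProjectiveObject C M) : gproj C M := by
  obtain ⟨X, hX, hX', h, ⟨e⟩⟩ := hM
  exact gproj_of_iso ((X.opcyclesIsCokernel 1 0 (by simp)).coconePointUniqueUpToIso
    (cokernelIsCokernel (X.d 1 0)) ≪≫ e.symm) (gproj_opcycles hX hX' h 0)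

lemma gproj_op_of_gorensteinInjectiveObject [HasExt.{w} Cᵒᵖ] {N : C}
    (hN : gorensteinInjectiveObject C N) : gproj Cᵒᵖ (op N) := by
  obtain ⟨Y, hY, hY', h, ⟨e⟩⟩ := hN
  exact gproj_of_iso (e ≪≫ (kernelIsKernel (Y.d 0 (-1))).conePointUniqueUpToIso
    (Y.cyclesIsKernel 0 (-1) (by simp))).op (gproj_op_cycles hY hY' h 0)

end TotallyAcyclic

section FiniteDimension

variable {C : Type u} [Category.{v} C] [Abelian C]

lemma Resolution.isZero_of_length_lt {M : C} {𝒳 : ObjectProperty C} (ρ : Resolution 𝒳 M) {n : ℕ}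
    (hn : ρ.length < n) : IsZero (ρ.X.X n) := by
  by_contra h
  exact hn.not_ge (le_iSup₂_of_le (f := fun (n : ℕ) (_ : ¬ IsZero (ρ.X.X n)) => (n : ℕ∞))
    n h le_rfl)

lemma Coresolution.isZero_of_length_lt {N : C} {𝒴 : ObjectProperty C} (ρ : Coresolution 𝒴 N)
    {n : ℕ} (hn : ρ.length < n) : IsZero (ρ.Y.X (-n)) := by
  by_contra h
  exact hn.not_ge (le_iSup₂_of_le (f := fun (n : ℕ) (_ : ¬ IsZero (ρ.Y.X (-n))) => (n : ℕ∞))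
    n h le_rfl)

lemma exists_hasGprojSyzygy_of_relProjDim_lt_top [HasExt.{w} C] {𝒳 : ObjectProperty C}
    (h𝒳 : ∀ X, 𝒳 X → gproj C X) {M : C} (hM : relProjDim 𝒳 M < ⊤) :
    ∃ d, HasGprojSyzygy d M := by
  obtain ⟨ρ, hρ⟩ := iInf_lt_iff.1 hM
  obtain ⟨b, hb⟩ := ENat.ne_top_iff_exists.1 hρ.ne
  have hZ : IsZero (ρ.X.opcycles (b + 1 : ℕ)) :=
    .of_epi (ρ.X.pOpcycles _) (ρ.isZero_of_length_lt (by rw [← hb]; exact_mod_cast b.lt_succ_self))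
  exact ⟨b + 1, .of_iso (hasGprojSyzygy_of_sequence (Z := fun n => ρ.X.opcycles n)
    (fun n => h𝒳 _ (ρ.mem n (by simp))) _ _ _
    (fun n => shortExact_opcycles ρ.X (by simp) (ρ.exactAt (by lia))) hZ) ρ.opcyclesIso⟩

lemma exists_hasGprojSyzygy_op_of_relInjDim_lt_top [HasExt.{w} Cᵒᵖ] {𝒴 : ObjectProperty C}
    (h𝒴 : ∀ Y, 𝒴 Y → gproj Cᵒᵖ (op Y)) {N : C} (hN : relInjDim 𝒴 N < ⊤) :
    ∃ d, HasGprojSyzygy d (op N) := by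
  obtain ⟨ρ, hρ⟩ := iInf_lt_iff.1 hN
  obtain ⟨b, hb⟩ := ENat.ne_top_iff_exists.1 hρ.ne
  have hZ : IsZero (ρ.Y.cycles (-(b + 1 : ℕ))) :=
    .of_mono (ρ.Y.iCycles _) (ρ.isZero_of_length_lt (by rw [← hb]; exact_mod_cast b.lt_succ_self))
  exact ⟨b + 1, .of_iso (hasGprojSyzygy_of_sequence (Z := fun n => op (ρ.Y.cycles (-n)))
    (fun n => h𝒴 _ (ρ.mem (-n) (by simp))) _ _ _
    (fun n => (shortExact_cycles ρ.Y (by simp) (ρ.exactAt (by lia))).op) hZ.op)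
    ρ.cyclesIso.symm.op⟩

end FiniteDimension

section Splicing

lemma exists_int_sequence {α : ℤ → Type*} {r : ∀ n, α (n + 1) → α n → Prop} {b : ℤ} (a : α b)
    (up : ∀ n, b ≤ n → ∀ x : α n, ∃ y, r n y x)
    (down : ∀ n, n < b → ∀ y : α (n + 1), ∃ x, r n y x) :
    ∃ t : ∀ n, α n, t b = a ∧ ∀ n, r n (t (n + 1)) (t n) := by
  choose f hf using up
  choose g hg using down
  let g' (n : ℤ) (hn : n ≤ b) (y : α n) : α (n - 1) := g (n - 1) (by lia) (cast (by simp) y)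
  let t (n : ℤ) : α n := n.inductionOn' b a f g'
  have hup (n : ℤ) (hn : b ≤ n) : t (n + 1) = f n hn (t n) := Int.inductionOn'_add_one hn
  have hdown (n : ℤ) (hn : n ≤ b) : t (n - 1) = g' n hn (t n) := Int.inductionOn'_sub_one hn
  refine ⟨t, Int.inductionOn'_self, fun n => ?_⟩
  rcases le_or_gt b n with hn | hn
  · rw [hup n hn]
    exact hf n hn _
  · have h : t n = g n hn (t (n + 1)) := by
      have := hdown (n + 1) hn
      grind
    rw [h]
    exact hg n hn _

variable {C : Type u} [Category.{v} C] [Abelian C]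

lemma exact_of_mono_fac {A X Y B : C} {f : A ⟶ X} {p : X ⟶ Y} {w : f ≫ p = 0}
    (h : (ShortComplex.mk f p w).Exact) {d : X ⟶ B} (i : Y ⟶ B) [Mono i] (fac : p ≫ i = d) :
    (ShortComplex.mk f d (by rw [← fac, reassoc_of% w, zero_comp])).Exact := by
  let φ : ShortComplex.mk f p w ⟶
      ShortComplex.mk f d (by rw [← fac, reassoc_of% w, zero_comp]) :=
    { τ₁ := 𝟙 _, τ₂ := 𝟙 _, τ₃ := i }
  exact (ShortComplex.exact_iff_of_epi_of_isIso_of_mono φ).1 h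

lemma exact_of_epi_fac {X Y B D : C} {i : Y ⟶ B} {g : B ⟶ D} {w : i ≫ g = 0}
    (h : (ShortComplex.mk i g w).Exact) {d : X ⟶ B} (p : X ⟶ Y) [Epi p] (fac : p ≫ i = d) :
    (ShortComplex.mk d g (by rw [← fac, Category.assoc, w, comp_zero])).Exact := by
  let φ : ShortComplex.mk d g (by rw [← fac, Category.assoc, w, comp_zero]) ⟶
      ShortComplex.mk i g w :=
    { τ₁ := p, τ₂ := 𝟙 _, τ₃ := 𝟙 _ }
  exact (ShortComplex.exact_iff_of_epi_of_isIso_of_mono φ).2 h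

variable (C) in
/-- Sequences `Z (n + 1) ⟶ X n ⟶ Z n` to be spliced into a complex with objects `X n`; when they
are short exact, `Z n` is its `n`-th syzygy, the cokernel of `X (n + 1) ⟶ X n`. -/
structure SplicingData where
  /-- the syzygies -/
  Z : ℤ → C
  /-- the objects of the spliced complex -/
  X : ℤ → C
  /-- the inclusions of the syzygies -/
  i (n : ℤ) : Z (n + 1) ⟶ X n
  /-- the projections onto the syzygies -/
  p (n : ℤ) : X n ⟶ Z n
  w (n : ℤ) : i n ≫ p n = 0

namespace SplicingData

variable (s : SplicingData C)

/-- The sequence `Z (n + 1) ⟶ X n ⟶ Z n`. -/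
abbrev sc (n : ℤ) : ShortComplex C := .mk (s.i n) (s.p n) (s.w n)

/-- The spliced complex, with differentials `X (n + 1) ⟶ Z (n + 1) ⟶ X n`. -/
abbrev complex : ChainComplex C ℤ :=
  ChainComplex.of s.X (fun n => s.p (n + 1) ≫ s.i n) fun n => by
    rw [Category.assoc, reassoc_of% s.w, zero_comp, comp_zero]

lemma complex_d (n : ℤ) : s.complex.d (n + 1) n = s.p (n + 1) ≫ s.i n :=
  ChainComplex.of_d s.X (fun n => s.p (n + 1) ≫ s.i n) n

lemma complex_d_p (n : ℤ) : s.complex.d (n + 1) n ≫ s.p n = 0 := by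
  rw [complex_d, Category.assoc, s.w, comp_zero]

variable {s}

lemma exact_d_p {n : ℤ} (h : (s.sc n).ShortExact) (h' : (s.sc (n + 1)).ShortExact) :
    (ShortComplex.mk (s.complex.d (n + 1) n) (s.p n) (s.complex_d_p n)).Exact := by
  have : Epi (s.p (n + 1)) := h'.epi_g
  exact exact_of_epi_fac h.exact (s.p (n + 1)) (s.complex_d n).symm

lemma exactAt_complex {n : ℤ} (h₀ : (s.sc n).ShortExact) (h₁ : (s.sc (n + 1)).ShortExact)
    (h₂ : (s.sc (n + 1 + 1)).ShortExact) : s.complex.ExactAt (n + 1) := by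
  have : Mono (s.i n) := h₀.mono_f
  rw [s.complex.exactAt_iff' (n + 1 + 1) (n + 1) n (by simp) (by simp)]
  exact exact_of_mono_fac (exact_d_p h₁ h₂) (s.i n) (s.complex_d n).symm

/-- A morphism `f : X (n + 1) ⟶ Q` with `d ≫ f = 0` factors through `Z (n + 1)`, where it extends
to `X n`. -/
lemma isHomToExact_complex (h : ∀ n, (s.sc n).ShortExact) {𝒲 : ObjectProperty C}
    (hext : ∀ n Q, 𝒲 Q → ∀ f : s.Z (n + 1) ⟶ Q, ∃ g : s.X n ⟶ Q, s.i n ≫ g = f) :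
    IsHomToExact 𝒲 s.complex := by
  intro Q hQ n
  obtain ⟨n, rfl⟩ : ∃ m, n = m + 1 := ⟨n - 1, by simp⟩
  rw [homTo_exactAt_iff Q _ rfl rfl]
  intro f hf
  have := (h (n + 1)).epi_g
  obtain ⟨g, hg⟩ := hext n Q hQ ((exact_d_p (h (n + 1)) (h _)).desc f hf)
  refine ⟨g, ?_⟩
  rw [complex_d, Category.assoc, hg]
  exact (exact_d_p (h (n + 1)) (h _)).g_desc f hf

/-- The chain map induced by compatible morphisms of the objects and of the syzygies. -/
def complexMap {s t : SplicingData C} (f : ∀ n, s.Z n ⟶ t.Z n) (φ : ∀ n, s.X n ⟶ t.X n)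
    (hi : ∀ n, s.i n ≫ φ n = f (n + 1) ≫ t.i n) (hp : ∀ n, s.p n ≫ f n = φ n ≫ t.p n) :
    s.complex ⟶ t.complex :=
  ChainComplex.ofHom φ fun n => by
    rw [complex_d, complex_d, Category.assoc, hi, ← reassoc_of% hp]

end SplicingData

end Splicing

section TateResolutions

variable {C : Type u} [Category.{v} C] [Abelian C]

lemma HasGprojSyzygy.exists_splicingData [HasExt.{w} C] {d : ℕ} {M : C}
    (h : HasGprojSyzygy d M) :
    ∃ s : SplicingData C, s.Z 0 = M ∧ (∀ n, Projective (s.X n)) ∧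
      (∀ n, n < 0 → IsZero (s.X n)) ∧ (∀ n, 0 ≤ n → (s.sc n).ShortExact) ∧
      ∀ n : ℤ, d ≤ n → gproj C (s.Z n) := by
  obtain ⟨Z, hZ, hr⟩ := exists_int_sequence
    (α := fun n => {K : C // 0 ≤ n → HasGprojSyzygy (d - n.toNat) K})
    (r := fun n K' K => ∃ (P : C) (i : K'.1 ⟶ P) (p : P ⟶ K.1) (w : i ≫ p = 0), Projective P ∧
      (0 ≤ n → (ShortComplex.mk i p w).ShortExact) ∧ (n < 0 → IsZero P))
    (b := 0) ⟨M, fun _ => h⟩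
    (fun n hn ⟨K, hK⟩ => by
      obtain ⟨K', hK', P, i, p, w, hP, hE⟩ := (hK hn).exists_syzygy
      exact ⟨⟨K', fun _ => by rwa [show d - (n + 1).toNat = d - n.toNat - 1 by lia]⟩,
        P, i, p, w, hP, fun _ => hE, fun h => by lia⟩)
    (fun n hn K' => ⟨⟨0, fun h => by lia⟩, 0, 0, 0, by simp,
      (isZero_zero C).projective, fun h => by lia, fun _ => isZero_zero C⟩)
  choose P i p w hP hE hP' using hr
  exact ⟨⟨fun n => (Z n).1, P, i, p, w⟩, congrArg Subtype.val hZ, hP, hP', hE, fun n hn => by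
    simpa [show d - n.toNat = 0 by lia, HasGprojSyzygy] using (Z n).2 (by lia)⟩

/-- Below degree `d` the totally acyclic complex is built from cosyzygies, and `φ` extends step by
step along their inclusions by orthogonality. -/
lemma SplicingData.exists_complete [HasExt.{w} C] (s : SplicingData C)
    (hs : ∀ n, Projective (s.X n)) {d : ℤ} (hd : ∀ n, d ≤ n → (s.sc n).ShortExact)
    (hd' : ∀ n, d ≤ n → gproj C (s.Z n)) :
    ∃ (t : SplicingData C) (φ : t.complex ⟶ s.complex), (∀ n, Projective (t.X n)) ∧
      (∀ n, (t.sc n).ShortExact) ∧ (∀ n, gproj C (t.Z n)) ∧ ∀ n, d ≤ n → IsIso (φ.f n) := by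
  have h := isGorensteinProjectiveClass_gproj C
  obtain ⟨F, -, hr⟩ := exists_int_sequence
    (α := fun n => {f : Over (s.Z n) // gproj C f.left ∧ (d ≤ n → IsIso f.hom)})
    (r := fun n f' f => ∃ (Q : C) (j : f'.1.left ⟶ Q) (q : Q ⟶ f.1.left) (w : j ≫ q = 0),
      Projective Q ∧ (ShortComplex.mk j q w).ShortExact ∧ ∃ φ : Q ⟶ s.X n,
        j ≫ φ = f'.1.hom ≫ s.i n ∧ q ≫ f.1.hom = φ ≫ s.p n ∧ (d ≤ n → IsIso φ))
    (b := d) ⟨Over.mk (𝟙 _), hd' d le_rfl, fun _ => inferInstanceAs (IsIso (𝟙 _))⟩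
    (fun n hn ⟨f, hf, hf'⟩ => by
      have := hf' hn
      exact ⟨⟨Over.mk (𝟙 (s.Z (n + 1))), hd' _ (by lia), fun _ => inferInstanceAs (IsIso (𝟙 _))⟩,
        s.X n, s.i n, s.p n ≫ inv f.hom, by simp [reassoc_of% s.w], hs n,
        by simpa using shortExact_of_isos (hd n hn) (Iso.refl _) (asIso f.hom).symm,
        𝟙 _, by simp, by simp, fun _ => inferInstance⟩)
    (fun n hn ⟨f', hf', _⟩ => by
      obtain ⟨G, hG, Q, j, q, w, hQ, hE⟩ := h.exists_cosyzygy _ hf'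
      obtain ⟨φ, hφ : j ≫ φ = f'.hom ≫ s.i n⟩ :=
        (h.orthogonal G hG).exists_extension hE (hs n) (f'.hom ≫ s.i n)
      have := hE.epi_g
      have hφ' : j ≫ φ ≫ s.p n = 0 := by rw [reassoc_of% hφ, s.w, comp_zero]
      exact ⟨⟨Over.mk (hE.exact.desc (φ ≫ s.p n) hφ'), hG, fun h => by lia⟩, Q, j, q, w, hQ, hE,
        φ, hφ, hE.exact.g_desc _ hφ', fun h => by lia⟩)
  choose Q j q w hQ hE φ hj hq hφ using hr
  exact ⟨⟨fun n => (F n).1.left, Q, j, q, w⟩,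
    SplicingData.complexMap (fun n => (F n).1.hom) φ hj hq, hQ, hE, fun n => (F n).2.1, hφ⟩

lemma Resolution.isProper_of_projective {M : C} (ρ : Resolution (isProjective C) M) :
    ρ.IsProper := by
  rintro A (hA : Projective A)
  have := ρ.quasiIso
  infer_instance

lemma Coresolution.isProper_of_injective {N : C} (ρ : Coresolution (isInjective C) N) :
    ρ.IsProper := by
  rintro A (hA : Injective A)
  have : QuasiIso ((HomologicalComplex.opFunctor C (ComplexShape.down ℤ)).map ρ.δ.op) :=
    (HomologicalComplex.quasiIso_opFunctor_map_iff _).2 ρ.quasiIso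
  infer_instance

/-- The chain map to `M` given by an augmentation. -/
def augmentation {X : ChainComplex C ℤ} {M : C} (ε : X.X 0 ⟶ M) (w : X.d 1 0 ≫ ε = 0) :
    X ⟶ inDegreeZero M :=
  HomologicalComplex.mkHomToSingle ε fun i (hi : 0 + 1 = i) => by subst hi; exact w

lemma quasiIso_augmentation {X : ChainComplex C ℤ} {M : C} {ε : X.X 0 ⟶ M} {w : X.d 1 0 ≫ ε = 0}
    (hX : ∀ n, n < 0 → IsZero (X.X n)) (hX' : ∀ n, 0 < n → X.ExactAt n)
    (h : (ShortComplex.mk _ _ w).Exact) [Epi ε] : QuasiIso (augmentation ε w) := by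
  refine ⟨fun n => ?_⟩
  rcases lt_trichotomy n 0 with hn | rfl | hn
  · rw [quasiIsoAt_iff_exactAt' _ _ (HomologicalComplex.exactAt_single_obj _ _ _ _ hn.ne)]
    exact .of_isZero (hX n hn)
  · have hf : ε ≫ (HomologicalComplex.singleObjXSelf _ _ _).inv = (augmentation ε w).f 0 :=
      (HomologicalComplex.mkHomToSingle_f _ _).symm
    rw [quasiIsoAt_iff' _ 1 0 (-1) (by simp) (by simp), ShortComplex.quasiIso_iff_of_zeros' _
      ((hX _ (by simp)).eq_of_tgt _ _) rfl rfl]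
    exact ⟨exact_of_mono_fac h _ hf, show Epi ((augmentation ε w).f 0) by rw [← hf]; infer_instance⟩
  · rw [quasiIsoAt_iff_exactAt' _ _ (HomologicalComplex.exactAt_single_obj _ _ _ _ hn.ne')]
    exact hX' n hn

/-- The augmented spliced complex is a projective resolution of the zeroth syzygy. -/
def SplicingData.resolution (s : SplicingData C) (hs : ∀ n, Projective (s.X n))
    (h₀ : ∀ n, n < 0 → IsZero (s.X n)) (h : ∀ n, 0 ≤ n → (s.sc n).ShortExact) :
    Resolution (isProjective C) (s.Z 0) where
  X := s.complex
  γ := augmentation (s.p 0) (s.complex_d_p 0)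
  mem n _ := hs n
  isZero := h₀
  quasiIso :=
    have : Epi (s.p 0) := (h 0 le_rfl).epi_g
    quasiIso_augmentation h₀ (fun n hn => by
      obtain ⟨m, rfl⟩ : ∃ m, n = m + 1 := ⟨n - 1, by simp⟩
      exact exactAt_complex (h m (by lia)) (h _ (by lia)) (h _ (by lia)))
      (exact_d_p (h 0 le_rfl) (h 1 (by simp)))

theorem HasGprojSyzygy.nonempty_tateResolution [HasExt.{w} C] {d : ℕ} {M : C}
    (h : HasGprojSyzygy d M) : Nonempty (TateResolution (isProjective C) M) := by
  obtain ⟨s, rfl, hs, h₀, hE, hd⟩ := h.exists_splicingData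
  obtain ⟨t, φ, ht, htE, htG, hφ⟩ := s.exists_complete (d := d) hs (fun n hn => hE n (by lia)) hd
  have hT : t.complex.Acyclic := fun n => by
    obtain ⟨m, rfl⟩ : ∃ m, n = m + 1 := ⟨n - 1, by simp⟩
    exact SplicingData.exactAt_complex (htE _) (htE _) (htE _)
  have hT' : IsHomToExact (isProjective C) t.complex :=
    SplicingData.isHomToExact_complex htE fun n Q hQ f =>
      ((isGorensteinProjectiveClass_gproj C).orthogonal _ (htG n)).exists_extension (htE n) hQ f
  let ρ := s.resolution hs h₀ hE
  exact ⟨{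
    T := t.complex
    W := ρ
    α := φ
    totallyAcyclic := ⟨ht, hT, isHomFromExact_isProjective hT, hT'⟩
    isProper := ρ.isProper_of_projective
    isIso := ⟨d, hφ⟩ }⟩

end TateResolutions

section Duality

variable {C : Type u} [Category.{v} C] [Abelian C]

/-- The complex of `C` obtained from a complex of `Cᵒᵖ` by reversing the arrows, with the object
of degree `-n` placed in degree `n`. -/
def unopNeg (X : ChainComplex Cᵒᵖ ℤ) : ChainComplex C ℤ where
  X n := unop (X.X (-n))
  d i j := (X.d (-j) (-i)).unop
  shape i j h := by
    rw [X.shape _ _ fun (h' : -i + 1 = -j) => h (show j + 1 = i by lia)]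
    rfl
  d_comp_d' _ _ _ _ _ := by rw [← unop_comp, X.d_comp_d]; rfl

/-- The functoriality of `unopNeg`. -/
def unopNegMap {X Y : ChainComplex Cᵒᵖ ℤ} (f : X ⟶ Y) : unopNeg Y ⟶ unopNeg X where
  f n := (f.f (-n)).unop
  comm' i j _ := congrArg Quiver.Hom.unop (f.comm (-j) (-i)).symm

lemma exactAt_unopNeg {X : ChainComplex Cᵒᵖ ℤ} {n : ℤ} (h : X.ExactAt (-n)) :
    (unopNeg X).ExactAt n := by
  rw [HomologicalComplex.exactAt_iff' _ (n + 1) n (n - 1) (by simp) (by simp)]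
  exact ((X.exactAt_iff' (-(n - 1)) (-n) (-(n + 1)) (by simp; ring) (by simp; ring)).1 h).unop

lemma quasiIso_unopNegMap {X Y : ChainComplex Cᵒᵖ ℤ} (f : X ⟶ Y) [QuasiIso f] :
    QuasiIso (unopNegMap f) := by
  refine ⟨fun n => ?_⟩
  rw [quasiIsoAt_iff' _ (n + 1) n (n - 1) (by simp) (by simp)]
  have := (quasiIsoAt_iff' f (-(n - 1)) (-n) (-(n + 1)) (by simp; ring) (by simp; ring)).1
    inferInstance
  exact ShortComplex.quasiIso_unopMap
    ((HomologicalComplex.shortComplexFunctor' Cᵒᵖ _ (-(n - 1)) (-n) (-(n + 1))).map f)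

variable (N : C)

lemma isZero_unopNeg_inDegreeZero {n : ℤ} (hn : n ≠ 0) :
    IsZero ((unopNeg (inDegreeZero (op N))).X n) :=
  (HomologicalComplex.isZero_single_obj_X _ _ _ _ (neg_ne_zero.2 hn)).unop

/-- The comparison of `N` with the dual of `op N`, as complexes in degree zero. -/
def inDegreeZeroToUnopNeg : inDegreeZero N ⟶ unopNeg (inDegreeZero (op N)) :=
  HomologicalComplex.mkHomFromSingle
    (HomologicalComplex.singleObjXSelf (ComplexShape.down ℤ) 0 (op N)).hom.unop
    fun k (hk : k + 1 = 0) => (isZero_unopNeg_inDegreeZero N (by lia)).eq_of_tgt _ _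

instance : IsIso (inDegreeZeroToUnopNeg N) := by
  have (n : ℤ) : IsIso ((inDegreeZeroToUnopNeg N).f n) := by
    rcases eq_or_ne n 0 with rfl | hn
    · let e := HomologicalComplex.singleObjXSelf (ComplexShape.down ℤ) 0 (op N)
      have hf : (inDegreeZeroToUnopNeg N).f 0 =
          (HomologicalComplex.singleObjXSelf _ 0 N).hom ≫ e.unop.hom :=
        HomologicalComplex.mkHomFromSingle_f _ _
      rw [hf]
      exact inferInstanceAs (IsIso ((HomologicalComplex.singleObjXSelf _ 0 N) ≪≫ e.unop).hom)
    · exact ⟨0, (HomologicalComplex.isZero_single_obj_X _ _ _ _ hn).eq_of_src _ _,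
        (isZero_unopNeg_inDegreeZero N hn).eq_of_src _ _⟩
  exact HomologicalComplex.Hom.isIso_of_components _

variable {N}

/-- The injective coresolution dual to a projective resolution in the opposite category. -/
def Resolution.unop (ρ : Resolution (isProjective Cᵒᵖ) (op N)) :
    Coresolution (isInjective C) N where
  Y := unopNeg ρ.X
  δ := inDegreeZeroToUnopNeg N ≫ unopNegMap ρ.γ
  mem n hn := by
    have : Projective (ρ.X.X (-n)) := ρ.mem (-n) (by lia)
    exact inferInstanceAs (Injective (Opposite.unop (ρ.X.X (-n))))
  isZero n hn := (ρ.isZero (-n) (by lia)).unop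
  quasiIso := by
    have := ρ.quasiIso
    have := quasiIso_unopNegMap ρ.γ
    infer_instance

lemma IsTotallyAcyclic.unopNeg {T : ChainComplex Cᵒᵖ ℤ}
    (hT : IsTotallyAcyclic (isProjective Cᵒᵖ) T) :
    IsTotallyAcyclic (isInjective C) (unopNeg T) where
  mem n := by
    have : Projective (T.X (-n)) := hT.mem (-n)
    exact inferInstanceAs (Injective (Opposite.unop (T.X (-n))))
  acyclic n := exactAt_unopNeg (hT.acyclic (-n))
  homFromExact Q (hQ : Injective Q) n := by
    rw [homFrom_exactAt_iff Q _ rfl (sub_add_cancel n 1)]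
    intro f hf
    obtain ⟨g, hg⟩ := (homTo_exactAt_iff (op Q) T (i := -(n - 1)) (k := -(n + 1)) (by ring)
      (by ring)).1 (hT.homToExact _ (inferInstanceAs (Projective (op Q))) (-n)) f.op
      (congrArg Quiver.Hom.op hf)
    exact ⟨g.unop, congrArg Quiver.Hom.unop hg⟩
  homToExact := isHomToExact_isInjective fun n => exactAt_unopNeg (hT.acyclic (-n))

/-- The Tate coresolution dual to a Tate resolution in the opposite category. -/
def TateResolution.unop (τ : TateResolution (isProjective Cᵒᵖ) (op N)) :
    TateCoresolution (isInjective C) N where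
  S := unopNeg τ.T
  V := τ.W.unop
  β := unopNegMap τ.α
  totallyAcyclic := τ.totallyAcyclic.unopNeg
  isProper := τ.W.unop.isProper_of_injective
  isIso := by
    obtain ⟨n₀, hα⟩ := τ.isIso
    refine ⟨-n₀, fun n hn => ?_⟩
    have := hα (-n) (by lia)
    exact inferInstanceAs (IsIso (τ.α.f (-n)).unop)

end Duality

section Existence

variable {C : Type u} [Category.{v} C] [Abelian C]

lemma nonempty_tateResolution_of_relProjDim_lt_top {M : C}
    (hM : relProjDim (gorensteinProjectiveObject C) M < ⊤) :
    Nonempty (TateResolution (isProjective C) M) := by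
  have := HasExt.standard C
  obtain ⟨d, hd⟩ := exists_hasGprojSyzygy_of_relProjDim_lt_top
    (fun _ => gproj_of_gorensteinProjectiveObject) hM
  exact hd.nonempty_tateResolution

lemma nonempty_tateCoresolution_of_relInjDim_lt_top {N : C}
    (hN : relInjDim (gorensteinInjectiveObject C) N < ⊤) :
    Nonempty (TateCoresolution (isInjective C) N) := by
  have := HasExt.standard Cᵒᵖ
  obtain ⟨d, hd⟩ := exists_hasGprojSyzygy_op_of_relInjDim_lt_top
    (fun _ => gproj_op_of_gorensteinInjectiveObject) hN
  exact hd.nonempty_tateResolution.map TateResolution.unop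

end Existence

end RelTate

end

open RelTate in
theorem corollary6p3_general {C : Type u} [Category.{v} C] [Abelian C] (R : Type w) [Ring R]
    [Linear R C] (M N : C) (hM : relProjDim (gorensteinProjectiveObject C) M < ⊤)
    (hN : relInjDim (gorensteinInjectiveObject C) N < ⊤) :
    Nonempty (TateResolution (isProjective C) M) ∧
    Nonempty (TateCoresolution (isInjective C) N) ∧
    ∀ (τ : TateResolution (isProjective C) M) (σ : TateCoresolution (isInjective C) N) (n : ℤ),
      Nonempty ((linHomTo R τ.T N).homology n ≅ (linHomFrom R M σ.S).homology (-n)) :=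
  ⟨nonempty_tateResolution_of_relProjDim_lt_top hM,
    nonempty_tateCoresolution_of_relInjDim_lt_top hN,
    nonempty_homology_linHomTo_iso_linHomFrom R⟩

open RelTate in
/-- Tate projective resolutions of `M` and Tate injective coresolutions of `N` exist, and whichever
are used to compute them, the two Tate cohomology modules are isomorphic over `R`. -/
theorem corollary6p3 (R : Type u) [CommRing R] (M N : ModuleCat.{u} R)
    (hM : gorensteinProjDim M < ⊤) (hN : gorensteinInjDim N < ⊤) :
    Nonempty (TateProjectiveResolution M) ∧ Nonempty (TateInjectiveCoresolution N) ∧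
    ∀ (τ : TateProjectiveResolution M) (σ : TateInjectiveCoresolution N),
      (∀ n : ℤ, 1 ≤ n → Nonempty (τ.tateExt N n ≅ σ.tateExt M n)) ∧
      (IsGorensteinRing R → ∀ n : ℤ, Nonempty (τ.tateExt N n ≅ σ.tateExt M n)) := by
  obtain ⟨hτ, hσ, h⟩ := corollary6p3_general R M N hM hN
  exact ⟨hτ, hσ, fun τ σ => ⟨fun n _ => h τ σ n, fun _ => h τ σ⟩⟩
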